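/- For an integer $n\ge 0$, an integer $k$ and complex numbers $x$ and $q\neq 0,-1$ let \[ d_{n,k}(x,q)=\det_{1\le i,j\le n}\left(\binom{x+i+j-2}{j-1}\,\frac{1-(-q)^{j-i+k}}{1+q}\right), \] where $\binom{z}{m}=z(z-1)\cdots(z-m+1)/m!$, and the determinant of the empty matrix is $1$. For an integer $j$ let $(z)_j=z(z+1)\cdots(z+j-1)$ if $j\geq 1$ and $(z)_j=1$ if $j\le 0$; thus each product over $i\ge 0$ below has only finitely many factors different from $1$. Powers of $q$ with exponent $\pm\frac n2$ are principal powers, i.e. $q^{m/2}=(q^{1/2})^{m}$ for integers $m$, where $q^{1/2}$ is the square root of $q$ with positive real part. Let $q\in\mathbb{C}$ be a primitive third root of unity. Then for all integers $n\ge 0$, all $k\in\mathbb{Z}$ and all $x\in\mathbb{C}$ \begin{align*} d_{n,6k+1}(x,q)=& 2^{\left\lfloor\frac{n}{2}\right\rfloor \left\lfloor\frac{n+1}{2}\right\rfloor} \prod_{i=1}^{\left\lfloor\frac{n+1}{2}\right\rfloor}\frac{(i-1)!}{(n-i)!} \prod_{i \geq 0} \left(\frac{x}{2}+3i+1\right)_{\left\lfloor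 \frac{n-4i}{2}\right\rfloor} \left(\frac{x}{2}+3i+3\right)_{\left\lfloor \frac{n-4i-3}{2}\right\rfloor}\\ &\times \prod_{i \geq 0} \left(\frac{x}{2}+n-i+\frac{1}{2}\right)_{\left\lfloor \frac{n-4i-1}{2}\right\rfloor} \left(\frac{x}{2}+n-i-\frac{1}{2}\right)_{\left\lfloor \frac{n-4i-2}{2}\right\rfloor},\\ d_{n,6k+2}(x,q)=& 2^{\left\lfloor\frac{n}{2}\right\rfloor \left\lfloor\frac{n+1}{2}\right\rfloor}3^{-\left\lfloor\frac{n}{2}\right\rfloor}(1-q)^{n} \prod_{i=1}^{\left\lfloor\frac{n+1}{2}\right\rfloor}\frac{(i-1)!}{(n-i)!}\\ &\times \prod_{i \geq 0} \left(\frac{x}{2}+n-i\right)_{\left\lfloor\frac{n-4i}{2}\right\rfloor} \left(\frac{x}{2}+n-i\right)_{\left\lfloor\frac{n-4i-3}{2}\right\rfloor}\\ &\times \prod_{i \geq 0} \left(\frac{x}{2}+3i+\frac{3}{2}\right)_{\left\lfloor\frac{n-4i-1}{2}\right\rfloor} \left(\frac{x}{2}+3i+\frac{5}{2}\right)_{\left\lfloor\frac{n-4i-2}{2}\right\rfloor},\\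 d_{n,6k+3}(x,q)=&(-q)^n2^{\left\lfloor\frac{n+1}{2}\right\rfloor \left\lfloor\frac{n+2}{2}\right\rfloor-\left\lfloor\frac{n}{2}\right\rfloor} \prod_{i=1}^{\left\lfloor\frac{n+1}{2}\right\rfloor}\frac{(i-1)!}{(n-i)!}\\ &\times \prod_{i \geq 0} \left(\frac{x}{2}+3i+2\right)_{\left\lfloor\frac{n-4i-1}{2}\right\rfloor} \left(\frac{x}{2}+3i+2\right)_{\left\lfloor\frac{n-4i-2}{2}\right\rfloor}\\ &\times \prod_{i \geq 0} \left(\frac{x}{2}+2\left\lfloor\frac{n}{2}\right\rfloor-i+\frac{1}{2}\right)_{\left\lfloor\frac{n-4i}{2}\right\rfloor} \left(\frac{x}{2}+2\left\lfloor\frac{n-1}{2}\right\rfloor-i+\frac{3}{2}\right)_{\left\lfloor\frac{n-4i-3}{2}\right\rfloor},\\ d_{n,6k+4}(x,q)=&q^{-\frac{n}{2}}\, d_{n,6k+2}(x,q),\\ d_{n,6k+5}(x,q)=&q^{-n}\, d_{n,6k+1}(x,q),\\ d_{2n+1,6k}(x,q)=&0,\\ d_{2n,6k}(x,q)=&q^{\frac{n}{2}}\,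 2^{n^2} \prod_{i=1}^{n}\frac{(i-1)!}{(2n-i)!} \\ &\times \prod_{i \geq 0} \left(\frac{x}{2}+3i+\frac{1}{2}\right)_{n-2i} \left(\frac{x}{2}+3i+\frac{7}{2}\right)_{n-2(i+1)} \left(\frac{x}{2}+2n-i\right)_{n-2i-1}^2. \end{align*} -/

import Mathlib

/-- The determinant of the `n × n` matrix with entries
`binom (x + i + j - 2) (j - 1) * (1 - (-q) ^ (j - i + k)) / (1 + q)`, `1 ≤ i, j ≤ n`.
An index `a : Fin n` stands for the row or column number `a + 1`, and
`Ring.choose z m = z (z - 1) ⋯ (z - m + 1) / m!` for complex `z`. -/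
noncomputable def dDet (n : ℕ) (k : ℤ) (x q : ℂ) : ℂ :=
  Matrix.det (Matrix.of fun i j : Fin n =>
    Ring.choose (x + ((i : ℕ) + 1) + ((j : ℕ) + 1) - 2) (j : ℕ) *
      ((1 - (-q) ^ ((j : ℤ) - (i : ℤ) + k)) / (1 + q)))

/-- The Pochhammer symbol `(x)_j = x (x + 1) ⋯ (x + j - 1)`, the empty product `1` if `j ≤ 0`. -/
noncomputable def poch (x : ℂ) (j : ℤ) : ℂ :=
  (ascPochhammer ℂ j.toNat).eval x

/-- The factorial quotient `∏_{i=1}^{m} (i - 1)! / (N - i)!`; it is used for `m ≤ N` only, so that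
the subtractions are honest. -/
noncomputable def factQuot (m N : ℕ) : ℂ :=
  ∏ i ∈ Finset.Icc 1 m, ((i - 1).factorial : ℂ) / ((N - i).factorial : ℂ)

/-!
# Evaluation of a family of binomial determinants at a primitive third root of unity

The proof is by condensation. Deleting the first row of the matrix of `dDet n k x q` gives a matrix
of the same kind with `(k - 1, x + 1)`; deleting the first column gives, up to factors of rows and
columns, one with `(k + 1, x + 1)`. The Desnanot–Jacobi identity (`det_condensation`) therefore
becomes a recurrence for the determinants themselves (`dDet_condensation`), which determines order
`n` from the orders `n - 1` and `n - 2` as long as the determinant of order `n - 2` is not zero.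

If `q` is a primitive third root of unity, `dDet` has period `6` in `k`, and transposition
(`dDet_neg`) exchanges `k` and `-k`, because the matrix of binomial coefficients is symmetric up to
factors of rows and columns. So `k = 0, 1, 2, 3` suffice, the recurrence is closed on these four
families, and for `k = 0` the determinants of odd order vanish by skew-symmetry.

With `y = x / 2`, every product in the evaluations is a `ladder`
`(z)_M (z + s)_{M - 2} (z + 2 s)_{M - 4} ⋯` with `s = 3` or `s = -1`. Removing the first factor of a
ladder lowers `M` by two and moves `z` by `s`, and the quotients of ladders in the recurrence reduce
in this way to a few linear factors in `y`. The recurrence then becomes an identity between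
polynomials in `y` of degree at most three, separately for `k = 0, 1, 2, 3` and for each parity of
the order (`EvenEvaluation.succ`, `OddEvaluation.succ`).

The division by the determinant of order `n - 2` is legitimate for non-real `x`, where no linear
factor with real zeros vanishes. Both sides of each evaluation are continuous in `x`, so the
evaluations extend to all `x`.
-/

/-! ### Condensation of determinants -/

/-- An invertible block bordered by row `a` and column `b` of `M`: its determinant is that of the
block times the entry `(a, b)` of the Schur complement. -/
theorem det_bordered {m : ℕ} {ι : Type*} (M : Matrix ι ι ℂ) (f : Fin m → ι) (a b : ι)
    [Invertible (M.submatrix f f)] :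
    (Matrix.of fun i j : Fin 1 ⊕ Fin m =>
        M (Sum.elim (fun _ => a) f i) (Sum.elim (fun _ => b) f j)).det =
      (M.submatrix f f).det *
        (M a b - ((M.submatrix (fun _ : Fin 1 => a) f) * ⅟(M.submatrix f f) *
          (M.submatrix f (fun _ : Fin 1 => b))) 0 0) := by
  have h : (Matrix.of fun i j : Fin 1 ⊕ Fin m =>
        M (Sum.elim (fun _ => a) f i) (Sum.elim (fun _ => b) f j)) =
      Matrix.fromBlocks (M.submatrix (fun _ => a) (fun _ => b)) (M.submatrix (fun _ => a) f)
        (M.submatrix f (fun _ => b)) (M.submatrix f f) := by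
    ext (i | i) (j | j) <;> rfl
  rw [h, Matrix.det_fromBlocks₂₂, Matrix.det_fin_one]
  rfl

/-- The bijection listing the first index of `Fin (m + 1)` separately. -/
noncomputable def finSplitFirst (m : ℕ) : Fin 1 ⊕ Fin m ≃ Fin (m + 1) :=
  Equiv.ofBijective (Sum.elim (fun _ => 0) Fin.succ) (by
    rw [Fintype.bijective_iff_injective_and_card]
    refine ⟨?_, by simp [add_comm]⟩
    rintro (i | i) (j | j) h
    · simp [Subsingleton.elim i j]
    · exact absurd h.symm (Fin.succ_ne_zero j)
    · exact absurd h (Fin.succ_ne_zero i)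
    · exact congrArg _ (Fin.succ_injective _ h))

/-- The bijection listing the last index of `Fin (m + 1)` separately. -/
noncomputable def finSplitLast (m : ℕ) : Fin 1 ⊕ Fin m ≃ Fin (m + 1) :=
  Equiv.ofBijective (Sum.elim (fun _ => Fin.last m) Fin.castSucc) (by
    rw [Fintype.bijective_iff_injective_and_card]
    refine ⟨?_, by simp [add_comm]⟩
    rintro (i | i) (j | j) h
    · simp [Subsingleton.elim i j]
    · exact absurd h.symm (Fin.castSucc_lt_last j).ne
    · exact absurd h (Fin.castSucc_lt_last i).ne
    · exact congrArg _ (Fin.castSucc_injective _ h))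

/-- The bijection listing the first and the last index of `Fin (m + 2)` separately. -/
noncomputable def finSplitEnds (m : ℕ) : Fin 2 ⊕ Fin m ≃ Fin (m + 2) :=
  Equiv.ofBijective (Sum.elim ![0, Fin.last (m + 1)] (fun i => i.castSucc.succ)) (by
    rw [Fintype.bijective_iff_injective_and_card]
    refine ⟨?_, by simp [add_comm]⟩
    rintro (i | i) (j | j) h
    · fin_cases i <;> fin_cases j <;> simp [Fin.ext_iff] at h ⊢
    · exfalso
      have := j.2
      fin_cases i <;> simp [Fin.ext_iff] at h
      omega
    · exfalso
      have := i.2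
      fin_cases j <;> simp [Fin.ext_iff] at h
      omega
    · simpa [Fin.ext_iff] using h)

/-- The Desnanot–Jacobi identity, for an invertible central block. Both sides are computed from the
`2 × 2` Schur complement of that block. -/
theorem det_condensation {m : ℕ} (M : Matrix (Fin (m + 2)) (Fin (m + 2)) ℂ)
    (h : (M.submatrix (fun i : Fin m => i.castSucc.succ) (fun i => i.castSucc.succ)).det ≠ 0) :
    M.det * (M.submatrix (fun i : Fin m => i.castSucc.succ) (fun i => i.castSucc.succ)).det =
      (M.submatrix Fin.castSucc Fin.castSucc).det * (M.submatrix Fin.succ Fin.succ).det -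
      (M.submatrix Fin.succ Fin.castSucc).det * (M.submatrix Fin.castSucc Fin.succ).det := by
  set f : Fin m → Fin (m + 2) := fun i => i.castSucc.succ with hf
  let : Invertible (M.submatrix f f) := Matrix.invertibleOfIsUnitDet _ h.isUnit
  set S : Fin (m + 2) → Fin (m + 2) → ℂ := fun a b =>
    M a b - ((M.submatrix (fun _ : Fin 1 => a) f) * ⅟(M.submatrix f f) *
      (M.submatrix f (fun _ : Fin 1 => b))) 0 0 with hS
  have hb := fun a b => det_bordered M f a b
  set e₁ := finSplitFirst m
  set e₂ := finSplitLast m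
  -- The two mixed minors list rows and columns by different bijections; both acquire the sign of
  -- the same permutation, and the signs cancel in the product.
  set σ : Equiv.Perm (Fin (m + 1)) := e₁.symm.trans e₂ with hσ
  have c₁ : ∀ i, (e₁ i).castSucc = Sum.elim (fun _ => (0 : Fin (m + 2))) f i := by
    rintro (i | i) <;> rfl
  have c₂ : ∀ i, (e₂ i).succ = Sum.elim (fun _ => Fin.last (m + 1)) f i := by
    rintro (i | i) <;> rfl
  have hM : M.det = (M.submatrix f f).det * (S 0 0 * S (Fin.last _) (Fin.last _) -
      S 0 (Fin.last _) * S (Fin.last _) 0) := by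
    have h1 : M.submatrix (finSplitEnds m) (finSplitEnds m) =
        Matrix.fromBlocks (M.submatrix ![0, Fin.last (m + 1)] ![0, Fin.last (m + 1)])
          (M.submatrix ![0, Fin.last (m + 1)] f) (M.submatrix f ![0, Fin.last (m + 1)])
          (M.submatrix f f) := by
      ext (i | i) (j | j) <;> rfl
    rw [← Matrix.det_submatrix_equiv_self (finSplitEnds m) M, h1, Matrix.det_fromBlocks₂₂,
      Matrix.det_fin_two]
    rfl
  have h00 : (M.submatrix Fin.castSucc Fin.castSucc).det = (M.submatrix f f).det * S 0 0 := by
    rw [← hb, ← Matrix.det_submatrix_equiv_self e₁]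
    congr 1; ext i j; simp [c₁]
  have h11 : (M.submatrix Fin.succ Fin.succ).det =
      (M.submatrix f f).det * S (Fin.last _) (Fin.last _) := by
    rw [← hb, ← Matrix.det_submatrix_equiv_self e₂]
    congr 1; ext i j; simp [c₂]
  have h10 : (Equiv.Perm.sign σ : ℂ) * (M.submatrix Fin.succ Fin.castSucc).det =
      (M.submatrix f f).det * S (Fin.last _) 0 := by
    rw [← Matrix.det_permute, ← hb, ← Matrix.det_submatrix_equiv_self e₁]
    congr 1; ext i j; simp [c₁, c₂, hσ]
  have h01 : (Equiv.Perm.sign σ : ℂ) * (M.submatrix Fin.castSucc Fin.succ).det =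
      (M.submatrix f f).det * S 0 (Fin.last _) := by
    rw [← Matrix.det_permute', ← hb, ← Matrix.det_submatrix_equiv_self e₁]
    congr 1; ext i j; simp [c₁, c₂, hσ]
  have hs : (Equiv.Perm.sign σ : ℂ) * (Equiv.Perm.sign σ : ℂ) = 1 := by
    rcases Int.units_eq_one_or (Equiv.Perm.sign σ) with h | h <;> simp [h]
  rw [hM, h00, h11]
  linear_combination (Equiv.Perm.sign σ : ℂ) * (M.submatrix Fin.castSucc Fin.succ).det * h10 +
    (M.submatrix f f).det * S (Fin.last _) 0 * h01 -
    (M.submatrix Fin.succ Fin.castSucc).det * (M.submatrix Fin.castSucc Fin.succ).det * hs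

/-! ### Pochhammer symbols -/

theorem poch_of_nonpos (z : ℂ) {j : ℤ} (hj : j ≤ 0) : poch z j = 1 := by
  simp [poch, Int.toNat_of_nonpos hj]

theorem poch_natCast_succ (z : ℂ) (n : ℕ) : poch z (n + 1 : ℕ) = poch z n * (z + n) := by
  simp only [poch, Int.toNat_natCast, ascPochhammer_succ_eval]

theorem poch_natCast_succ_left (z : ℂ) (n : ℕ) :
    poch z (n + 1 : ℕ) = z * poch (z + 1) n := by
  simp [poch, ascPochhammer_succ_left, -Nat.cast_add]

theorem poch_eq_mul_last (z : ℂ) {j : ℤ} (hj : 1 ≤ j) :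
    poch z j = poch z (j - 1) * (z + j - 1) := by
  obtain ⟨n, rfl⟩ : ∃ n : ℕ, j = (n + 1 : ℕ) := ⟨(j - 1).toNat, by omega⟩
  rw [poch_natCast_succ]
  push_cast
  ring_nf

theorem poch_eq_first_mul (z : ℂ) {j : ℤ} (hj : 1 ≤ j) :
    poch z j = z * poch (z + 1) (j - 1) := by
  obtain ⟨n, rfl⟩ : ∃ n : ℕ, j = (n + 1 : ℕ) := ⟨(j - 1).toNat, by omega⟩
  rw [poch_natCast_succ_left]
  push_cast
  ring_nf

theorem poch_ne_zero {z : ℂ} (hz : z.im ≠ 0) (j : ℤ) : poch z j ≠ 0 := by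
  obtain hj | ⟨n, rfl⟩ : j ≤ 0 ∨ ∃ n : ℕ, j = n := by
    rcases le_total j 0 with h | h
    · exact .inl h
    · exact .inr ⟨j.toNat, by omega⟩
  · simp [poch_of_nonpos z hj]
  · induction n with
    | zero => simp [poch]
    | succ n ih =>
      rw [poch_natCast_succ]
      refine mul_ne_zero ih fun h => hz ?_
      simpa using congrArg Complex.im h

theorem poch_natCast_add (z : ℂ) (m n : ℕ) :
    poch z (m + n : ℕ) = poch z m * poch (z + m) n := by
  induction n with
  | zero => simp [poch]
  | succ n ih =>
    rw [← add_assoc, poch_natCast_succ, ih, poch_natCast_succ]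
    push_cast
    ring

/-! ### The determinants -/

/-- The entry of the matrix of `dDet` in row `i` and column `j`, counted from zero. -/
noncomputable def dEntry (k : ℤ) (x q : ℂ) (i j : ℕ) : ℂ :=
  poch (x + i + 1) j / (j.factorial : ℂ) * ((1 - (-q) ^ ((j : ℤ) - (i : ℤ) + k)) / (1 + q))

theorem choose_eq_poch_div (z : ℂ) (j : ℕ) :
    Ring.choose z j = poch (z - j + 1) j / (j.factorial : ℂ) := by
  rw [Ring.choose_eq_smul, Polynomial.descPochhammer_smeval_eq_ascPochhammer,
    Polynomial.ascPochhammer_smeval_eq_eval, poch, Int.toNat_natCast, smul_eq_mul]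
  ring

theorem dDet_eq_det_dEntry (n : ℕ) (k : ℤ) (x q : ℂ) :
    dDet n k x q = (Matrix.of fun i j : Fin n => dEntry k x q i j).det := by
  unfold dDet
  congr 1
  ext i j
  simp only [Matrix.of_apply, choose_eq_poch_div, dEntry]
  congr 3
  ring

theorem dEntry_succ_row (k : ℤ) (x q : ℂ) (i j : ℕ) :
    dEntry k x q (i + 1) j = dEntry (k - 1) (x + 1) q i j := by
  unfold dEntry
  congr 2
  · congr 1
    push_cast
    ring
  · congr 2
    push_cast
    ring

theorem dEntry_succ_column (k : ℤ) (x q : ℂ) (i j : ℕ) :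
    dEntry k x q i (j + 1) =
      (x + i + 1) * (((j : ℂ) + 1)⁻¹ * dEntry (k + 1) (x + 1) q i j) := by
  have h1 : ((j + 1 : ℕ) : ℤ) - (i : ℤ) + k = (j : ℤ) - (i : ℤ) + (k + 1) := by
    push_cast
    ring
  have h2 : x + i + 1 + 1 = x + 1 + i + 1 := by ring
  have h3 : (j : ℂ) + 1 ≠ 0 := by exact_mod_cast Nat.succ_ne_zero j
  have h4 : (j.factorial : ℂ) ≠ 0 := by exact_mod_cast j.factorial_ne_zero
  unfold dEntry
  rw [h1, poch_natCast_succ_left, Nat.factorial_succ, h2]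
  push_cast
  field_simp

theorem det_dEntry_succ_column (N : ℕ) (k : ℤ) (x q : ℂ) :
    (Matrix.of fun i j : Fin N => dEntry k x q i ((j : ℕ) + 1)).det =
      (∏ i : Fin N, (x + 1 + (i : ℕ))) *
        ((∏ j : Fin N, (((j : ℕ) : ℂ) + 1)⁻¹) * dDet N (k + 1) (x + 1) q) := by
  rw [dDet_eq_det_dEntry, ← Matrix.det_mul_row, ← Matrix.det_mul_column]
  congr 1
  ext i j
  simp only [Matrix.of_apply, dEntry_succ_column]
  ring

theorem dDet_submatrix_shift (N : ℕ) (k : ℤ) (x q : ℂ) :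
    (Matrix.of fun i j : Fin N => dEntry k x q ((i : ℕ) + 1) ((j : ℕ) + 1)).det =
      (∏ i : Fin N, (x + 2 + (i : ℕ))) *
        ((∏ j : Fin N, (((j : ℕ) : ℂ) + 1)⁻¹) * dDet N k (x + 2) q) := by
  simp only [dEntry_succ_row]
  rw [det_dEntry_succ_column, sub_add_cancel, add_assoc, one_add_one_eq_two]

/-- The condensation recurrence: deleting the first row or column of the matrix of `dDet`
produces, up to factors of rows and columns, a matrix of the same kind. -/
theorem dDet_condensation (m : ℕ) (k : ℤ) {x : ℂ} (q : ℂ) (hx : x.im ≠ 0)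
    (h : dDet m k (x + 2) q ≠ 0) :
    ((m : ℂ) + 1) * (dDet (m + 2) k x q * dDet m k (x + 2) q) =
      (x + m + 2) * (dDet (m + 1) k x q * dDet (m + 1) k (x + 2) q) -
      (x + 1) * (dDet (m + 1) (k - 1) (x + 1) q * dDet (m + 1) (k + 1) (x + 1) q) := by
  set M : Matrix (Fin (m + 2)) (Fin (m + 2)) ℂ := Matrix.of fun i j => dEntry k x q i j with hM
  have inner : (M.submatrix (fun i : Fin m => i.castSucc.succ) (fun i => i.castSucc.succ)).det =
      (∏ i : Fin m, (x + 2 + (i : ℕ))) *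
        ((∏ j : Fin m, (((j : ℕ) : ℂ) + 1)⁻¹) * dDet m k (x + 2) q) :=
    dDet_submatrix_shift m k x q
  have hss : (M.submatrix Fin.succ Fin.succ).det = (∏ i : Fin (m + 1), (x + 2 + (i : ℕ))) *
        ((∏ j : Fin (m + 1), (((j : ℕ) : ℂ) + 1)⁻¹) * dDet (m + 1) k (x + 2) q) :=
    dDet_submatrix_shift (m + 1) k x q
  have hcc : (M.submatrix Fin.castSucc Fin.castSucc).det = dDet (m + 1) k x q := by
    rw [dDet_eq_det_dEntry]
    rfl
  have hcs : (M.submatrix Fin.castSucc Fin.succ).det = (∏ i : Fin (m + 1), (x + 1 + (i : ℕ))) *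
        ((∏ j : Fin (m + 1), (((j : ℕ) : ℂ) + 1)⁻¹) * dDet (m + 1) (k + 1) (x + 1) q) :=
    det_dEntry_succ_column (m + 1) k x q
  have hsc : (M.submatrix Fin.succ Fin.castSucc).det = dDet (m + 1) (k - 1) (x + 1) q := by
    rw [dDet_eq_det_dEntry]
    congr 1
    ext i j
    simp [hM, dEntry_succ_row]
  have hP : ∏ i : Fin m, (x + 2 + ((i : ℕ) : ℂ)) ≠ 0 := by
    refine Finset.prod_ne_zero_iff.2 fun i _ hi => hx ?_
    simpa using congrArg Complex.im hi
  have hm : (m : ℂ) + 1 ≠ 0 := by exact_mod_cast Nat.succ_ne_zero m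
  have hQ : ∏ j : Fin m, (((j : ℕ) : ℂ) + 1)⁻¹ ≠ 0 := by
    refine Finset.prod_ne_zero_iff.2 fun i _ => inv_ne_zero ?_
    exact_mod_cast Nat.succ_ne_zero i
  have hP1 : ∏ i : Fin (m + 1), (x + 2 + ((i : ℕ) : ℂ)) =
      (∏ i : Fin m, (x + 2 + ((i : ℕ) : ℂ))) * (x + 2 + m) := by
    simp [Fin.prod_univ_castSucc]
  have hP2 : ∏ i : Fin (m + 1), (x + 1 + ((i : ℕ) : ℂ)) =
      (x + 1) * ∏ i : Fin m, (x + 2 + ((i : ℕ) : ℂ)) := by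
    rw [Fin.prod_univ_succ]
    simp only [Fin.val_zero, Fin.val_succ, Nat.cast_zero, add_zero, Nat.cast_add, Nat.cast_one]
    congr 2
    ext i
    ring
  have hQ1 : ∏ j : Fin (m + 1), (((j : ℕ) : ℂ) + 1)⁻¹ =
      (∏ j : Fin m, (((j : ℕ) : ℂ) + 1)⁻¹) * ((m : ℂ) + 1)⁻¹ := by
    rw [Fin.prod_univ_castSucc]
    simp only [Fin.val_castSucc, Fin.val_last]
  have key := det_condensation M (by rw [inner]; exact mul_ne_zero hP (mul_ne_zero hQ h))
  rw [inner, hss, hcc, hcs, hsc, hP1, hP2, hQ1, ← dDet_eq_det_dEntry] at key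
  set P := ∏ i : Fin m, (x + 2 + ((i : ℕ) : ℂ))
  set Q := ∏ j : Fin m, (((j : ℕ) : ℂ) + 1)⁻¹
  refine mul_left_cancel₀ (mul_ne_zero hP hQ) ?_
  have h1 : ((m : ℂ) + 1) * ((m : ℂ) + 1)⁻¹ = 1 := mul_inv_cancel₀ hm
  linear_combination ((m : ℂ) + 1) * key + P * Q *
    ((x + m + 2) * (dDet (m + 1) k x q * dDet (m + 1) k (x + 2) q) -
      (x + 1) * (dDet (m + 1) (k - 1) (x + 1) q * dDet (m + 1) (k + 1) (x + 1) q)) * h1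

/-- Transposition relates `k` and `-k`: up to factors of rows and columns, the matrix of binomial
coefficients is the symmetric matrix with entries `(x + 1)_{i + j}`. -/
theorem dDet_neg (n : ℕ) (k : ℤ) {x q : ℂ} (hx : x.im ≠ 0) (hq : q ≠ 0) :
    dDet n (-k) x q = (-(-q) ^ (-k)) ^ n * dDet n k x q := by
  have hs : -q ≠ 0 := neg_ne_zero.2 hq
  have hg : ∀ i : ℕ, poch (x + 1) i ≠ 0 := fun i => poch_ne_zero (by simpa using hx) _
  have hf : ∀ i : ℕ, (i.factorial : ℂ) ≠ 0 := fun i => by exact_mod_cast i.factorial_ne_zero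
  have he : ∀ i j : ℕ, dEntry (-k) x q j i =
      (poch (x + 1) i / (i.factorial : ℂ) * (-q) ^ (i : ℤ)) *
        ((-(-q) ^ (-k) * ((j.factorial : ℂ) / poch (x + 1) j * (-q) ^ (-(j : ℤ)))) *
          dEntry k x q i j) := by
    intro i j
    have h1 : poch (x + 1) j * poch (x + j + 1) i = poch (x + 1) i * poch (x + i + 1) j := by
      have a := poch_natCast_add (x + 1) i j
      have b := poch_natCast_add (x + 1) j i
      rw [add_comm j i, a] at b
      rw [show x + j + 1 = x + 1 + j by ring, show x + i + 1 = x + 1 + i by ring, b]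
    have h2 : (-q) ^ ((i : ℤ) - (j : ℤ) + -k) =
        (-q) ^ (i : ℤ) * ((-q) ^ (-(j : ℤ)) * (-q) ^ (-k)) := by
      rw [← zpow_add₀ hs, ← zpow_add₀ hs]
      ring_nf
    have h3 : (-q) ^ (i : ℤ) * ((-q) ^ (-(j : ℤ)) * (-q) ^ (-k)) *
        (-q) ^ ((j : ℤ) - (i : ℤ) + k) = 1 := by
      rw [← zpow_add₀ hs, ← zpow_add₀ hs, ← zpow_add₀ hs]
      ring_nf
      simp
    have h4 : poch (x + j + 1) i = poch (x + 1) i * poch (x + i + 1) j / poch (x + 1) j := by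
      rw [← h1, mul_div_cancel_left₀ _ (hg j)]
    unfold dEntry
    rw [h2, h4]
    have h5 : 1 - (-q) ^ (i : ℤ) * ((-q) ^ (-(j : ℤ)) * (-q) ^ (-k)) =
        -((-q) ^ (i : ℤ) * ((-q) ^ (-(j : ℤ)) * (-q) ^ (-k))) *
          (1 - (-q) ^ ((j : ℤ) - (i : ℤ) + k)) := by
      linear_combination -h3
    rw [h5]
    have := hg i
    have := hg j
    have := hf i
    have := hf j
    generalize (-q) ^ ((j : ℤ) - (i : ℤ) + k) = t
    generalize (-q) ^ (i : ℤ) = a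
    generalize (-q) ^ (-(j : ℤ)) = b
    generalize (-q) ^ (-k) = c
    field_simp
  have hprod : (∏ i : Fin n, (poch (x + 1) (i : ℕ) / ((i : ℕ).factorial : ℂ) *
      (-q) ^ ((i : ℕ) : ℤ))) * ∏ j : Fin n, (-(-q) ^ (-k) * (((j : ℕ).factorial : ℂ) /
        poch (x + 1) (j : ℕ) * (-q) ^ (-((j : ℕ) : ℤ)))) = (-(-q) ^ (-k)) ^ n := by
    rw [← Finset.prod_mul_distrib, ← Fin.prod_const]
    refine Finset.prod_congr rfl fun i _ => ?_
    have h1 : (-q) ^ ((i : ℕ) : ℤ) * (-q) ^ (-((i : ℕ) : ℤ)) = 1 := by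
      rw [← zpow_add₀ hs]
      simp
    have h2 : poch (x + 1) (i : ℕ) / ((i : ℕ).factorial : ℂ) * (((i : ℕ).factorial : ℂ) /
        poch (x + 1) (i : ℕ)) = 1 := by
      have := hg i
      have := hf i
      field_simp
    linear_combination (-(-q) ^ (-k)) * (h2 + poch (x + 1) (i : ℕ) / ((i : ℕ).factorial : ℂ) *
      (((i : ℕ).factorial : ℂ) / poch (x + 1) (i : ℕ)) * h1)
  rw [← hprod, mul_assoc, dDet_eq_det_dEntry n k, ← Matrix.det_mul_row, ← Matrix.det_mul_column,
    dDet_eq_det_dEntry, ← Matrix.det_transpose]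
  congr 1
  ext i j
  exact he i j

theorem dDet_add_six_mul (n : ℕ) (k l : ℤ) (x : ℂ) {q : ℂ} (hq : q ^ 3 = 1) :
    dDet n (6 * l + k) x q = dDet n k x q := by
  have hs : -q ≠ 0 := by
    rintro h
    rw [neg_eq_zero.1 h] at hq
    norm_num at hq
  have h6 : (-q) ^ (6 : ℤ) = 1 := by
    norm_cast
    linear_combination (q ^ 3 + 1) * hq
  unfold dDet
  congr 1
  ext i j
  simp only [Matrix.of_apply]
  rw [show ((j : ℕ) : ℤ) - ((i : ℕ) : ℤ) + (6 * l + k) = 6 * l + (((j : ℕ) : ℤ) - ((i : ℕ) : ℤ) + k)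
    by ring, zpow_add₀ hs, zpow_mul, h6, one_zpow, one_mul]

/-! ### Ladders of Pochhammer symbols -/

/-- The product `(z)_M (z + s)_{M - 2} (z + 2 s)_{M - 4} ⋯` of Pochhammer symbols whose lengths drop
by two while their arguments move by `s`. All products in the evaluations of the determinants are
of this form, with `s = 3` or `s = -1`. -/
noncomputable def ladder (s : ℂ) (M : ℤ) (z : ℂ) : ℂ :=
  ∏ᶠ i : ℕ, poch (z + s * i) (M - 2 * i)

theorem mulSupport_ladder_subset (s : ℂ) (M : ℤ) (z : ℂ) {N : ℕ} (hN : M ≤ N) :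
    (Function.mulSupport fun i : ℕ => poch (z + s * i) (M - 2 * i)) ⊆ (Finset.range N : Set ℕ) := by
  intro i hi
  by_contra h
  refine hi (poch_of_nonpos _ ?_)
  simp only [Finset.coe_range, Set.mem_Iio, not_lt] at h
  omega

theorem ladder_mulSupport_finite (s : ℂ) (M : ℤ) (z : ℂ) :
    (Function.mulSupport fun i : ℕ => poch (z + s * i) (M - 2 * i)).Finite :=
  (Finset.finite_toSet _).subset (mulSupport_ladder_subset s M z (Int.self_le_toNat M))

theorem ladder_eq_prod_range (s : ℂ) (M : ℤ) (z : ℂ) {N : ℕ} (hN : M ≤ N) :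
    ladder s M z = ∏ i ∈ Finset.range N, poch (z + s * i) (M - 2 * i) :=
  finprod_eq_prod_of_mulSupport_subset _ (mulSupport_ladder_subset s M z hN)

theorem ladder_of_nonpos (s : ℂ) {M : ℤ} (z : ℂ) (hM : M ≤ 0) : ladder s M z = 1 := by
  rw [ladder_eq_prod_range s M z (N := 0) (by simpa using hM), Finset.prod_range_zero]

theorem ladder_step (s : ℂ) (M : ℤ) (z : ℂ) :
    ladder s M z = poch z M * ladder s (M - 2) (z + s) := by
  rw [ladder_eq_prod_range s M z (N := M.toNat + 1) (by push_cast; omega),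
    ladder_eq_prod_range s (M - 2) (z + s) (N := M.toNat) (by omega), Finset.prod_range_succ',
    mul_comm]
  congr 1
  · simp
  · refine Finset.prod_congr rfl fun i _ => ?_
    congr 1
    · push_cast
      ring
    · push_cast
      ring

theorem ladder_one (s z : ℂ) : ladder s 1 z = z := by
  rw [ladder_step, ladder_of_nonpos _ _ (by norm_num), mul_one, poch_eq_mul_last _ le_rfl,
    poch_of_nonpos _ (by norm_num)]
  simp

theorem ladder_ne_zero {s z : ℂ} (hs : s.im = 0) (hz : z.im ≠ 0) (M : ℤ) : ladder s M z ≠ 0 := by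
  rw [ladder_eq_prod_range s M z (Int.self_le_toNat M)]
  refine Finset.prod_ne_zero_iff.2 fun i _ => poch_ne_zero ?_ _
  simpa [hs] using hz

/-- `ladder_step` with names for the shortened length and the moved argument, so that both can be
brought to the form in which an induction hypothesis mentions them. -/
theorem ladder_eq_mul (s : ℂ) {M M' : ℤ} {z z' : ℂ} (hM : M - 2 = M') (hz : z + s = z') :
    ladder s M z = poch z M * ladder s M' z' := by
  rw [ladder_step, hM, hz]

/-- The factor `c` if `p` is odd, and `1` if `p` is even. -/
noncomputable def oddFactor (p : ℕ) (c : ℂ) : ℂ := if Odd p then c else 1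

/-- The factor `c` if `p` is even, and `1` if `p` is odd. -/
noncomputable def evenFactor (p : ℕ) (c : ℂ) : ℂ := if Even p then c else 1

/-- In a condensation step the ladders with `s = 3` contribute a linear factor for one parity of
`p` only, and those with `s = -1` contribute the same linear factor for the other parity. Together
they contribute it always. -/
theorem oddFactor_mul_evenFactor (p : ℕ) (c : ℂ) : oddFactor p c * evenFactor p c = c := by
  rcases Nat.even_or_odd p with h | h
  · simp [oddFactor, evenFactor, h, Nat.not_odd_iff_even.2 h]
  · simp [oddFactor, evenFactor, h, Nat.not_even_iff_odd.2 h]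

theorem oddFactor_add_two (p : ℕ) (c : ℂ) : oddFactor (p + 2) c = oddFactor p c := by
  simp [oddFactor, Nat.odd_add]

theorem evenFactor_add_two (p : ℕ) (c : ℂ) : evenFactor (p + 2) c = evenFactor p c := by
  simp [evenFactor, Nat.even_add]

/-! ### Relations between four ladders

The recurrence for the determinants compares ladders of adjacent lengths and arguments. The
quotients that occur are rational functions with a bounded number of factors. They are invariant,
up to the stated factors, when the first Pochhammer symbol of each of the four ladders is removed,
which lowers `p` by two. -/

theorem ladder_cross_start (s z : ℂ) {p : ℤ} (hp : 1 ≤ p) :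
    ladder s p z * ladder s (p - 3) (z + 1 + s) =
      z * (ladder s (p - 1) (z + 1) * ladder s (p - 2) (z + s)) := by
  rw [ladder_step s p z, ladder_step s (p - 1) (z + 1), poch_eq_first_mul z hp,
    show p - 1 - 2 = p - 3 by ring]
  ring

theorem ladder_cross_end (s z : ℂ) {p : ℤ} (hp : 1 ≤ p) :
    ladder s p z * ladder s (p - 3) (z + s) =
      (z + p - 1) * (ladder s (p - 1) z * ladder s (p - 2) (z + s)) := by
  rw [ladder_step s p z, ladder_step s (p - 1) z, poch_eq_mul_last z hp,
    show p - 1 - 2 = p - 3 by ring]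
  ring

theorem ladder_cross_one (s : ℂ) (p : ℕ) : ∀ z : ℂ,
    oddFactor p (z + s * (p - 1) / 2) * (ladder s (p - 1) z * ladder s (p - 1) (z + 1)) =
      ladder s (p - 2) (z + 1) * ladder s p z := by
  induction p using Nat.twoStepInduction with
  | zero => intro z; simp [oddFactor, ladder_of_nonpos]
  | one => intro z; simp [oddFactor, ladder_of_nonpos, ladder_one]
  | more p ih _ =>
    intro z
    have e : oddFactor (p + 2) (z + s * (((p + 2 : ℕ) : ℂ) - 1) / 2) =
        oddFactor p (z + s + s * ((p : ℂ) - 1) / 2) := by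
      rw [oddFactor_add_two]
      congr 1
      push_cast
      ring
    have h := ih (z + s)
    rw [e]
    push_cast
    rw [ladder_eq_mul s (M := (p : ℤ) + 2 - 1) (M' := p - 1) (by ring) rfl,
      ladder_eq_mul s (M := (p : ℤ) + 2 - 1) (M' := p - 1) (z := z + 1) (z' := z + s + 1)
        (by ring) (by ring),
      ladder_eq_mul s (M := (p : ℤ) + 2 - 2) (M' := p - 2) (z := z + 1) (z' := z + s + 1)
        (by ring) (by ring),
      ladder_eq_mul s (M := (p : ℤ) + 2) (M' := p) (by ring) rfl]
    have p1 := poch_eq_mul_last (z + 1) (j := (p : ℤ) + 2 - 1) (by omega)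
    have p2 := poch_eq_mul_last z (j := (p : ℤ) + 2) (by omega)
    rw [show (p : ℤ) + 2 - 1 - 1 = p + 2 - 2 by ring] at p1
    rw [p1, p2]
    push_cast
    linear_combination poch z (p + 2 - 1) * poch (z + 1) (p + 2 - 2) * (z + 1 + (p + 2 - 1) - 1) * h

theorem ladder_three_cross_two (p : ℕ) : ∀ v : ℂ,
    evenFactor p (v + 3 * p / 2 - 1) * (ladder 3 p v * ladder 3 (p - 2) (v + 2)) =
      (v + p - 1) * (ladder 3 (p - 1) v * ladder 3 (p - 1) (v + 2)) := by
  induction p using Nat.twoStepInduction with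
  | zero => intro z; simp [evenFactor, ladder_of_nonpos]
  | one => intro z; simp [evenFactor, ladder_of_nonpos, ladder_one]
  | more p ih _ =>
    intro v
    have e : evenFactor (p + 2) (v + 3 * ((p + 2 : ℕ) : ℂ) / 2 - 1) =
        evenFactor p (v + 3 + 3 * (p : ℂ) / 2 - 1) := by
      rw [evenFactor_add_two]
      congr 1
      push_cast
      ring
    have h := ih (v + 3)
    rw [e]
    push_cast
    rw [ladder_eq_mul 3 (M := (p : ℤ) + 2 - 1) (M' := p - 1) (by ring) rfl,
      ladder_eq_mul 3 (M := (p : ℤ) + 2 - 1) (M' := p - 1) (z := v + 2) (z' := v + 3 + 2)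
        (by ring) (by ring),
      ladder_eq_mul 3 (M := (p : ℤ) + 2 - 2) (M' := p - 2) (z := v + 2) (z' := v + 3 + 2)
        (by ring) (by ring),
      ladder_eq_mul 3 (M := (p : ℤ) + 2) (M' := p) (by ring) rfl]
    have p1 := poch_eq_mul_last (v + 2) (j := (p : ℤ) + 2 - 1) (by omega)
    have p2 := poch_eq_mul_last v (j := (p : ℤ) + 2) (by omega)
    rw [show (p : ℤ) + 2 - 1 - 1 = p + 2 - 2 by ring] at p1
    rw [p1, p2]
    push_cast
    linear_combination poch v (p + 2 - 1) * poch (v + 2) (p + 2 - 2) * (v + p + 1) * h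

theorem ladder_neg_one_cross_shift (p : ℕ) : ∀ w : ℂ,
    evenFactor p (w - p / 2) * (ladder (-1) p (w + 1) * ladder (-1) (p - 2) (w - 1)) =
      (w + p) * (ladder (-1) (p - 1) (w - 1) * ladder (-1) (p - 1) (w + 1)) := by
  induction p using Nat.twoStepInduction with
  | zero => intro z; simp [evenFactor, ladder_of_nonpos]
  | one => intro z; simp [evenFactor, ladder_of_nonpos, ladder_one]
  | more p ih _ =>
    intro w
    have e : evenFactor (p + 2) (w - ((p + 2 : ℕ) : ℂ) / 2) =
        evenFactor p (w - 1 - (p : ℂ) / 2) := by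
      rw [evenFactor_add_two]
      congr 1
      push_cast
      ring
    have h := ih (w - 1)
    rw [e]
    push_cast
    rw [ladder_eq_mul (-1) (M := (p : ℤ) + 2 - 1) (M' := p - 1) (z := w - 1) (z' := w - 1 - 1)
        (by ring) (by ring),
      ladder_eq_mul (-1) (M := (p : ℤ) + 2 - 1) (M' := p - 1) (z := w + 1) (z' := w - 1 + 1)
        (by ring) (by ring),
      ladder_eq_mul (-1) (M := (p : ℤ) + 2 - 2) (M' := p - 2) (z := w - 1) (z' := w - 1 - 1)
        (by ring) (by ring),
      ladder_eq_mul (-1) (M := (p : ℤ) + 2) (M' := p) (z := w + 1) (z' := w - 1 + 1)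
        (by ring) (by ring)]
    have p1 := poch_eq_mul_last (w - 1) (j := (p : ℤ) + 2 - 1) (by omega)
    have p2 := poch_eq_mul_last (w + 1) (j := (p : ℤ) + 2) (by omega)
    rw [show (p : ℤ) + 2 - 1 - 1 = p + 2 - 2 by ring] at p1
    rw [p1, p2]
    push_cast
    linear_combination poch (w + 1) (p + 2 - 1) * poch (w - 1) (p + 2 - 2) * (w + p + 2) * h

theorem ladder_neg_one_cross_same (p : ℕ) : ∀ w : ℂ,
    evenFactor p (w - p / 2) * (ladder (-1) p w * ladder (-1) (p - 2) w) =
      w * (ladder (-1) (p - 1) (w - 1) * ladder (-1) (p - 1) (w + 1)) := by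
  induction p using Nat.twoStepInduction with
  | zero => intro z; simp [evenFactor, ladder_of_nonpos]
  | one => intro z; simp [evenFactor, ladder_of_nonpos, ladder_one]
  | more p ih _ =>
    intro w
    have e : evenFactor (p + 2) (w - ((p + 2 : ℕ) : ℂ) / 2) =
        evenFactor p (w - 1 - (p : ℂ) / 2) := by
      rw [evenFactor_add_two]
      congr 1
      push_cast
      ring
    have h := ih (w - 1)
    rw [e]
    push_cast
    rw [ladder_eq_mul (-1) (M := (p : ℤ) + 2 - 1) (M' := p - 1) (z := w - 1) (z' := w - 1 - 1)
        (by ring) (by ring),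
      ladder_eq_mul (-1) (M := (p : ℤ) + 2 - 1) (M' := p - 1) (z := w + 1) (z' := w - 1 + 1)
        (by ring) (by ring),
      ladder_eq_mul (-1) (M := (p : ℤ) + 2 - 2) (M' := p - 2) (z := w) (z' := w - 1)
        (by ring) (by ring),
      ladder_eq_mul (-1) (M := (p : ℤ) + 2) (M' := p) (z := w) (z' := w - 1)
        (by ring) (by ring)]
    have p1 := poch_eq_first_mul (w - 1) (j := (p : ℤ) + 2 - 1) (by omega)
    have p2 := poch_eq_first_mul w (j := (p : ℤ) + 2) (by omega)
    rw [show (p : ℤ) + 2 - 1 - 1 = p + 2 - 2 by ring, sub_add_cancel] at p1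
    rw [p1, p2]
    linear_combination w * poch (w + 1) (p + 2 - 1) * poch w (p + 2 - 2) * h

theorem ladder_three_cross_one (p : ℕ) : ∀ t : ℂ,
    (t + p - 2 + (p / 2 : ℕ)) * (ladder 3 (p - 1) t * ladder 3 (p - 2) (t + 1)) =
      (t + p - 2) * (ladder 3 (p - 2) t * ladder 3 (p - 1) (t + 1)) := by
  induction p using Nat.twoStepInduction with
  | zero => intro z; simp [ladder_of_nonpos]
  | one => intro z; simp [ladder_of_nonpos]
  | more p ih _ =>
    intro t
    have h := ih (t + 3)
    rw [Nat.add_div_right p two_pos]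
    push_cast at h ⊢
    rw [ladder_eq_mul 3 (M := (p : ℤ) + 2 - 1) (M' := p - 1) (by ring) rfl,
      ladder_eq_mul 3 (M := (p : ℤ) + 2 - 1) (M' := p - 1) (z := t + 1) (z' := t + 3 + 1)
        (by ring) (by ring),
      ladder_eq_mul 3 (M := (p : ℤ) + 2 - 2) (M' := p - 2) (z := t + 1) (z' := t + 3 + 1)
        (by ring) (by ring),
      ladder_eq_mul 3 (M := (p : ℤ) + 2 - 2) (M' := p - 2) (by ring) rfl]
    have p1 := poch_eq_mul_last (t + 1) (j := (p : ℤ) + 2 - 1) (by omega)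
    have p2 := poch_eq_mul_last t (j := (p : ℤ) + 2 - 1) (by omega)
    rw [show (p : ℤ) + 2 - 1 - 1 = p + 2 - 2 by ring] at p1 p2
    rw [p1, p2]
    push_cast
    linear_combination poch t (p + 2 - 2) * poch (t + 1) (p + 2 - 2) * (t + p) * h

theorem ladder_neg_one_cross_two (p : ℕ) : ∀ w : ℂ,
    (w - 1 - ((p + 1) / 2 : ℕ)) * (ladder (-1) (p + 1) w * ladder (-1) (p - 2) (w - 2)) =
      (w + p) * (w + p - 1) * (ladder (-1) p (w - 2) * ladder (-1) (p - 1) w) := by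
  induction p using Nat.twoStepInduction with
  | zero => intro z; simp [ladder_of_nonpos, ladder_one]; ring
  | one =>
    intro z
    have h := ladder_step (-1) 2 z
    have h2 := poch_eq_mul_last z (j := 2) (by norm_num)
    have h3 := poch_eq_mul_last z (j := 1) (by norm_num)
    norm_num at h2 h3
    rw [poch_of_nonpos _ le_rfl] at h3
    simp [ladder_of_nonpos, ladder_one, h, h2, h3]
    ring
  | more p ih _ =>
    intro w
    have h := ih (w - 1)
    rw [show p + 2 + 1 = p + 1 + 2 by ring, Nat.add_div_right (p + 1) two_pos]
    push_cast at h ⊢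
    rw [ladder_eq_mul (-1) (M := (p : ℤ) + 2 + 1) (M' := p + 1) (z := w) (z' := w - 1)
        (by ring) (by ring),
      ladder_eq_mul (-1) (M := (p : ℤ) + 2 - 2) (M' := p - 2) (z := w - 2) (z' := w - 1 - 2)
        (by ring) (by ring),
      ladder_eq_mul (-1) (M := (p : ℤ) + 2) (M' := p) (z := w - 2) (z' := w - 1 - 2)
        (by ring) (by ring),
      ladder_eq_mul (-1) (M := (p : ℤ) + 2 - 1) (M' := p - 1) (z := w) (z' := w - 1)
        (by ring) (by ring)]
    have p1 := poch_eq_mul_last w (j := (p : ℤ) + 2 + 1) (by omega)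
    have p2 := poch_eq_mul_last w (j := (p : ℤ) + 2) (by omega)
    have p3 := poch_eq_mul_last (w - 2) (j := (p : ℤ) + 2) (by omega)
    have p4 := poch_eq_mul_last (w - 2) (j := (p : ℤ) + 2 - 1) (by omega)
    rw [show (p : ℤ) + 2 + 1 - 1 = p + 2 by ring] at p1
    rw [show (p : ℤ) + 2 - 1 - 1 = p + 2 - 2 by ring] at p4
    rw [p1, p2, p3, p4]
    push_cast
    linear_combination poch w (p + 2 - 1) * poch (w - 2) (p + 2 - 2) * (w + p + 1) *
      (w + p + 2) * h

theorem ladder_neg_one_cross_middle (p : ℕ) : ∀ w : ℂ,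
    (w - 1 - (p / 2 : ℕ)) * (ladder (-1) (p - 1) (w - 1) * ladder (-1) (p - 2) (w - 1)) =
      (w - 1) * (ladder (-1) (p - 1) (w - 2) * ladder (-1) (p - 2) w) := by
  induction p using Nat.twoStepInduction with
  | zero => intro z; simp [ladder_of_nonpos]
  | one => intro z; simp [ladder_of_nonpos]
  | more p ih _ =>
    intro w
    have h := ih (w - 1)
    rw [Nat.add_div_right p two_pos]
    push_cast at h ⊢
    rw [ladder_eq_mul (-1) (M := (p : ℤ) + 2 - 1) (M' := p - 1) (z := w - 1) (z' := w - 1 - 1)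
        (by ring) (by ring),
      ladder_eq_mul (-1) (M := (p : ℤ) + 2 - 1) (M' := p - 1) (z := w - 2) (z' := w - 1 - 2)
        (by ring) (by ring),
      ladder_eq_mul (-1) (M := (p : ℤ) + 2 - 2) (M' := p - 2) (z := w - 1) (z' := w - 1 - 1)
        (by ring) (by ring),
      ladder_eq_mul (-1) (M := (p : ℤ) + 2 - 2) (M' := p - 2) (z := w) (z' := w - 1)
        (by ring) (by ring)]
    have p1 := poch_eq_first_mul (w - 1) (j := (p : ℤ) + 2 - 1) (by omega)
    have p2 := poch_eq_first_mul (w - 2) (j := (p : ℤ) + 2 - 1) (by omega)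
    rw [show (p : ℤ) + 2 - 1 - 1 = p + 2 - 2 by ring] at p1 p2
    rw [sub_add_cancel] at p1
    rw [show w - 2 + 1 = w - 1 by ring] at p2
    rw [p1, p2]
    linear_combination (w - 1) * poch w (p + 2 - 2) * poch (w - 1) (p + 2 - 2) * h

/-! ### The products in the evaluations -/

/-- The product in the evaluation of `dDet (2 * p) 0 (2 * y) q`. -/
noncomputable def evenProd0 (p : ℕ) (y : ℂ) : ℂ :=
  ladder 3 p (y + 1 / 2) * ladder 3 (p - 2) (y + 7 / 2) * ladder (-1) (p - 1) (y + 2 * p) ^ 2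

/-- The product in the evaluation of `dDet (2 * p) 1 (2 * y) q`. -/
noncomputable def evenProd1 (p : ℕ) (y : ℂ) : ℂ :=
  ladder 3 p (y + 1) * ladder 3 (p - 2) (y + 3) *
    (ladder (-1) (p - 1) (y + 2 * p + 1 / 2) * ladder (-1) (p - 1) (y + 2 * p - 1 / 2))

/-- The product in the evaluation of `dDet (2 * p + 1) 1 (2 * y) q`. -/
noncomputable def oddProd1 (p : ℕ) (y : ℂ) : ℂ :=
  ladder 3 p (y + 1) * ladder 3 (p - 1) (y + 3) *
    (ladder (-1) p (y + 2 * p + 3 / 2) * ladder (-1) (p - 1) (y + 2 * p + 1 / 2))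

/-- The product in the evaluation of `dDet (2 * p) 2 (2 * y) q`. -/
noncomputable def evenProd2 (p : ℕ) (y : ℂ) : ℂ :=
  ladder (-1) p (y + 2 * p) * ladder (-1) (p - 2) (y + 2 * p) *
    (ladder 3 (p - 1) (y + 3 / 2) * ladder 3 (p - 1) (y + 5 / 2))

/-- The product in the evaluation of `dDet (2 * p + 1) 2 (2 * y) q`. -/
noncomputable def oddProd2 (p : ℕ) (y : ℂ) : ℂ :=
  ladder (-1) p (y + 2 * p + 1) * ladder (-1) (p - 1) (y + 2 * p + 1) *
    (ladder 3 p (y + 3 / 2) * ladder 3 (p - 1) (y + 5 / 2))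

/-- The product in the evaluation of `dDet (2 * p) 3 (2 * y) q`. -/
noncomputable def evenProd3 (p : ℕ) (y : ℂ) : ℂ :=
  ladder 3 (p - 1) (y + 2) * ladder 3 (p - 1) (y + 2) *
    (ladder (-1) p (y + 2 * p + 1 / 2) * ladder (-1) (p - 2) (y + 2 * p - 1 / 2))

/-- The product in the evaluation of `dDet (2 * p + 1) 3 (2 * y) q`. -/
noncomputable def oddProd3 (p : ℕ) (y : ℂ) : ℂ :=
  ladder 3 p (y + 2) * ladder 3 (p - 1) (y + 2) *
    (ladder (-1) p (y + 2 * p + 1 / 2) * ladder (-1) (p - 1) (y + 2 * p + 3 / 2))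

theorem evenProd0_succ (r : ℕ) (y : ℂ) : evenProd0 (r + 1) y =
    ladder 3 (r + 1) (y + 1 / 2) * ladder 3 (r - 1) (y + 7 / 2) *
      ladder (-1) r (y + 2 * r + 2) ^ 2 := by
  simp only [evenProd0]; push_cast; ring_nf

theorem evenProd1_succ (r : ℕ) (y : ℂ) : evenProd1 (r + 1) y =
    ladder 3 (r + 1) (y + 1) * ladder 3 (r - 1) (y + 3) *
      (ladder (-1) r (y + 2 * r + 5 / 2) * ladder (-1) r (y + 2 * r + 3 / 2)) := by
  simp only [evenProd1]; push_cast; ring_nf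

theorem oddProd1_succ (r : ℕ) (y : ℂ) : oddProd1 (r + 1) y =
    ladder 3 (r + 1) (y + 1) * ladder 3 r (y + 3) *
      (ladder (-1) (r + 1) (y + 2 * r + 7 / 2) * ladder (-1) r (y + 2 * r + 5 / 2)) := by
  simp only [oddProd1]; push_cast; ring_nf

theorem evenProd2_succ (r : ℕ) (y : ℂ) : evenProd2 (r + 1) y =
    ladder (-1) (r + 1) (y + 2 * r + 2) * ladder (-1) (r - 1) (y + 2 * r + 2) *
      (ladder 3 r (y + 3 / 2) * ladder 3 r (y + 5 / 2)) := by
  simp only [evenProd2]; push_cast; ring_nf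

theorem oddProd2_succ (r : ℕ) (y : ℂ) : oddProd2 (r + 1) y =
    ladder (-1) (r + 1) (y + 2 * r + 3) * ladder (-1) r (y + 2 * r + 3) *
      (ladder 3 (r + 1) (y + 3 / 2) * ladder 3 r (y + 5 / 2)) := by
  simp only [oddProd2]; push_cast; ring_nf

theorem evenProd3_succ (r : ℕ) (y : ℂ) : evenProd3 (r + 1) y =
    ladder 3 r (y + 2) * ladder 3 r (y + 2) *
      (ladder (-1) (r + 1) (y + 2 * r + 5 / 2) * ladder (-1) (r - 1) (y + 2 * r + 3 / 2)) := by
  simp only [evenProd3]; push_cast; ring_nf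

theorem oddProd3_succ (r : ℕ) (y : ℂ) : oddProd3 (r + 1) y =
    ladder 3 (r + 1) (y + 2) * ladder 3 r (y + 2) *
      (ladder (-1) (r + 1) (y + 2 * r + 5 / 2) * ladder (-1) r (y + 2 * r + 7 / 2)) := by
  simp only [oddProd3]; push_cast; ring_nf

/-! ### Relations between the products

These compare the three terms of the condensation recurrence, for each `k` and each parity of the
order. A lemma `evenProdk_cross` or `oddProdk_cross` compares the left side, which contains the
products for orders `n` and `n - 2`, with a term of order `n - 1` on the right. The lemmas on
products for two different `k`, or on squares, compare the term with `k - 1` and `k + 1`. -/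

theorem evenProd1_cross (r : ℕ) (y : ℂ) :
    evenProd1 (r + 1) y * evenProd1 r (y + 1) =
      (y + r + 1) * (oddProd1 r y * oddProd1 r (y + 1)) := by
  have h := ladder_cross_end 3 (y + 1) (p := (r : ℤ) + 1) (by omega)
  have e1 : evenProd1 r (y + 1) = ladder 3 r (y + 2) * ladder 3 (r - 2) (y + 4) *
      (ladder (-1) (r - 1) (y + 2 * r + 3 / 2) * ladder (-1) (r - 1) (y + 2 * r + 1 / 2)) := by
    simp only [evenProd1]; ring_nf
  have e2 : oddProd1 r (y + 1) = ladder 3 r (y + 2) * ladder 3 (r - 1) (y + 4) *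
      (ladder (-1) r (y + 2 * r + 5 / 2) * ladder (-1) (r - 1) (y + 2 * r + 3 / 2)) := by
    simp only [oddProd1]; ring_nf
  rw [show (r : ℤ) + 1 - 3 = r - 2 by ring, show (r : ℤ) + 1 - 1 = r by ring,
    show (r : ℤ) + 1 - 2 = r - 1 by ring, show y + 1 + 3 = y + 4 by ring] at h
  push_cast at h
  rw [evenProd1_succ, e1, e2, oddProd1]
  linear_combination ladder 3 (r - 1) (y + 3) * ladder (-1) r (y + 2 * r + 5 / 2) *
    ladder (-1) r (y + 2 * r + 3 / 2) * ladder 3 r (y + 2) *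
    ladder (-1) (r - 1) (y + 2 * r + 3 / 2) * ladder (-1) (r - 1) (y + 2 * r + 1 / 2) * h

theorem evenProd0_cross (r : ℕ) (y : ℂ) :
    evenProd0 (r + 1) y * evenProd0 r (y + 1) = (y + 1 / 2) * oddProd1 r (y + 1 / 2) ^ 2 := by
  have h := ladder_cross_start 3 (y + 1 / 2) (p := (r : ℤ) + 1) (by omega)
  have e1 : evenProd0 r (y + 1) = ladder 3 r (y + 3 / 2) * ladder 3 (r - 2) (y + 9 / 2) *
      ladder (-1) (r - 1) (y + 2 * r + 1) ^ 2 := by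
    simp only [evenProd0]; ring_nf
  have e2 : oddProd1 r (y + 1 / 2) = ladder 3 r (y + 3 / 2) * ladder 3 (r - 1) (y + 7 / 2) *
      (ladder (-1) r (y + 2 * r + 2) * ladder (-1) (r - 1) (y + 2 * r + 1)) := by
    simp only [oddProd1]; ring_nf
  rw [show (r : ℤ) + 1 - 3 = r - 2 by ring, show (r : ℤ) + 1 - 1 = r by ring,
    show (r : ℤ) + 1 - 2 = r - 1 by ring, show y + 1 / 2 + 1 + 3 = y + 9 / 2 by ring,
    show y + 1 / 2 + 1 = y + 3 / 2 by ring, show y + 1 / 2 + 3 = y + 7 / 2 by ring] at h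
  rw [evenProd0_succ, e1, e2]
  linear_combination ladder 3 (r - 1) (y + 7 / 2) * ladder (-1) r (y + 2 * r + 2) ^ 2 *
    ladder 3 r (y + 3 / 2) * ladder (-1) (r - 1) (y + 2 * r + 1) ^ 2 * h

theorem evenProd1_shift (r : ℕ) (y : ℂ) : evenProd1 (r + 1) (y + 1) =
    ladder 3 (r + 1) (y + 2) * ladder 3 (r - 1) (y + 4) *
      (ladder (-1) r (y + 2 * r + 7 / 2) * ladder (-1) r (y + 2 * r + 5 / 2)) := by
  rw [evenProd1_succ]; ring_nf

/-- The instance of `ladder_cross_one` for `s = 3` at length `r + 1`. -/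
theorem ladder_three_cross_one_succ (r : ℕ) (z : ℂ) :
    oddFactor (r + 1) (z + 3 * r / 2) * (ladder 3 r z * ladder 3 r (z + 1)) =
      ladder 3 (r - 1) (z + 1) * ladder 3 (r + 1) z := by
  have h := ladder_cross_one 3 (r + 1) z
  push_cast at h
  rw [add_sub_cancel_right, add_sub_cancel_right, show (r : ℤ) + 1 - 2 = r - 1 by ring] at h
  exact h

theorem ladder_neg_one_cross_shift_succ (r : ℕ) (w : ℂ) :
    evenFactor (r + 1) (w - (r + 1) / 2) *
        (ladder (-1) (r + 1) (w + 1) * ladder (-1) (r - 1) (w - 1)) =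
      (w + r + 1) * (ladder (-1) r (w - 1) * ladder (-1) r (w + 1)) := by
  have h := ladder_neg_one_cross_shift (r + 1) w
  push_cast at h
  rw [add_sub_cancel_right, show (r : ℤ) + 1 - 2 = r - 1 by ring] at h
  rw [h]
  ring

theorem ladder_neg_one_cross_same_succ (r : ℕ) (w : ℂ) :
    evenFactor (r + 1) (w - (r + 1) / 2) * (ladder (-1) (r + 1) w * ladder (-1) (r - 1) w) =
      w * (ladder (-1) r (w - 1) * ladder (-1) r (w + 1)) := by
  have h := ladder_neg_one_cross_same (r + 1) w
  push_cast at h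
  rw [add_sub_cancel_right, show (r : ℤ) + 1 - 2 = r - 1 by ring] at h
  exact h

theorem oddProd1_cross (r : ℕ) (y : ℂ) :
    (y + (3 * r + 4) / 2) * (oddProd1 (r + 1) y * oddProd1 r (y + 1)) =
      (y + 3 * r + 7 / 2) * (evenProd1 (r + 1) y * evenProd1 (r + 1) (y + 1)) := by
  have h1 := ladder_three_cross_one_succ r (y + 2)
  have h2 := ladder_neg_one_cross_shift_succ r (y + 2 * r + 5 / 2)
  have hc := oddFactor_mul_evenFactor (r + 1) (y + (3 * r + 4) / 2)
  have e2 : oddProd1 r (y + 1) = ladder 3 r (y + 2) * ladder 3 (r - 1) (y + 4) *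
      (ladder (-1) r (y + 2 * r + 5 / 2) * ladder (-1) (r - 1) (y + 2 * r + 3 / 2)) := by
    simp only [oddProd1]; ring_nf
  rw [show y + 2 + 3 * (r : ℂ) / 2 = y + (3 * r + 4) / 2 by ring,
    show y + 2 + 1 = y + 3 by ring] at h1
  rw [show y + 2 * (r : ℂ) + 5 / 2 - (r + 1) / 2 = y + (3 * r + 4) / 2 by ring,
    show y + 2 * (r : ℂ) + 5 / 2 + 1 = y + 2 * r + 7 / 2 by ring,
    show y + 2 * (r : ℂ) + 5 / 2 - 1 = y + 2 * r + 3 / 2 by ring] at h2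
  rw [evenProd1_shift, evenProd1_succ, oddProd1_succ, e2, ← hc]
  generalize oddFactor (r + 1) (y + (3 * r + 4) / 2) = a at *
  generalize evenFactor (r + 1) (y + (3 * r + 4) / 2) = b at *
  linear_combination ladder 3 (r + 1) (y + 1) * ladder 3 (r - 1) (y + 4) *
    ladder (-1) r (y + 2 * r + 5 / 2) ^ 2 *
    (b * (ladder (-1) (r + 1) (y + 2 * r + 7 / 2) * ladder (-1) (r - 1) (y + 2 * r + 3 / 2)) * h1 +
      ladder 3 (r - 1) (y + 3) * ladder 3 (r + 1) (y + 2) * h2)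

theorem evenProd0_mul_evenProd2 (r : ℕ) (y : ℂ) :
    (y + (3 * r + 4) / 2) * (evenProd0 (r + 1) (y + 1 / 2) * evenProd2 (r + 1) (y + 1 / 2)) =
      (y + 2 * r + 5 / 2) * (evenProd1 (r + 1) y * evenProd1 (r + 1) (y + 1)) := by
  have h1 := ladder_three_cross_one_succ r (y + 2)
  have h2 := ladder_neg_one_cross_same_succ r (y + 2 * r + 5 / 2)
  have hc := oddFactor_mul_evenFactor (r + 1) (y + (3 * r + 4) / 2)
  have e0 : evenProd0 (r + 1) (y + 1 / 2) = ladder 3 (r + 1) (y + 1) * ladder 3 (r - 1) (y + 4) *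
      ladder (-1) r (y + 2 * r + 5 / 2) ^ 2 := by
    rw [evenProd0_succ]; ring_nf
  have e2 : evenProd2 (r + 1) (y + 1 / 2) =
      ladder (-1) (r + 1) (y + 2 * r + 5 / 2) * ladder (-1) (r - 1) (y + 2 * r + 5 / 2) *
        (ladder 3 r (y + 2) * ladder 3 r (y + 3)) := by
    rw [evenProd2_succ]; ring_nf
  rw [show y + 2 + 3 * (r : ℂ) / 2 = y + (3 * r + 4) / 2 by ring,
    show y + 2 + 1 = y + 3 by ring] at h1
  rw [show y + 2 * (r : ℂ) + 5 / 2 - (r + 1) / 2 = y + (3 * r + 4) / 2 by ring,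
    show y + 2 * (r : ℂ) + 5 / 2 + 1 = y + 2 * r + 7 / 2 by ring,
    show y + 2 * (r : ℂ) + 5 / 2 - 1 = y + 2 * r + 3 / 2 by ring] at h2
  rw [evenProd1_shift, evenProd1_succ, e0, e2, ← hc]
  generalize oddFactor (r + 1) (y + (3 * r + 4) / 2) = a at *
  generalize evenFactor (r + 1) (y + (3 * r + 4) / 2) = b at *
  linear_combination ladder 3 (r + 1) (y + 1) * ladder 3 (r - 1) (y + 4) *
    ladder (-1) r (y + 2 * r + 5 / 2) ^ 2 *
    (b * (ladder (-1) (r + 1) (y + 2 * r + 5 / 2) * ladder (-1) (r - 1) (y + 2 * r + 5 / 2)) * h1 +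
      ladder 3 (r - 1) (y + 3) * ladder 3 (r + 1) (y + 2) * h2)

theorem oddProd2_shift (r : ℕ) (y : ℂ) : oddProd2 r (y + 1) =
    ladder (-1) r (y + 2 * r + 2) * ladder (-1) (r - 1) (y + 2 * r + 2) *
      (ladder 3 r (y + 5 / 2) * ladder 3 (r - 1) (y + 7 / 2)) := by
  simp only [oddProd2]; ring_nf

theorem evenProd2_cross (r : ℕ) (y : ℂ) :
    evenProd2 (r + 1) y * evenProd2 r (y + 1) =
      (y + 3 * r + 2) * (oddProd2 r y * oddProd2 r (y + 1)) := by
  have h := ladder_cross_end (-1) (y + 2 * r + 2) (p := (r : ℤ) + 1) (by omega)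
  have e1 : evenProd2 r (y + 1) =
      ladder (-1) r (y + 2 * r + 1) * ladder (-1) (r - 2) (y + 2 * r + 1) *
        (ladder 3 (r - 1) (y + 5 / 2) * ladder 3 (r - 1) (y + 7 / 2)) := by
    simp only [evenProd2]; ring_nf
  rw [show (r : ℤ) + 1 - 3 = r - 2 by ring, show (r : ℤ) + 1 - 1 = r by ring,
    show (r : ℤ) + 1 - 2 = r - 1 by ring,
    show y + 2 * (r : ℂ) + 2 + -1 = y + 2 * r + 1 by ring] at h
  push_cast at h
  rw [evenProd2_succ, e1, oddProd2_shift, oddProd2]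
  linear_combination ladder (-1) (r - 1) (y + 2 * r + 2) * ladder 3 r (y + 3 / 2) *
    ladder 3 r (y + 5 / 2) * ladder (-1) r (y + 2 * r + 1) * ladder 3 (r - 1) (y + 5 / 2) *
    ladder 3 (r - 1) (y + 7 / 2) * h

theorem oddProd1_mul_oddProd3 (r : ℕ) (y : ℂ) :
    oddProd1 r (y + 1 / 2) * oddProd3 r (y + 1 / 2) = oddProd2 r y * oddProd2 r (y + 1) := by
  have e1 : oddProd1 r (y + 1 / 2) = ladder 3 r (y + 3 / 2) * ladder 3 (r - 1) (y + 7 / 2) *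
      (ladder (-1) r (y + 2 * r + 2) * ladder (-1) (r - 1) (y + 2 * r + 1)) := by
    simp only [oddProd1]; ring_nf
  have e3 : oddProd3 r (y + 1 / 2) = ladder 3 r (y + 5 / 2) * ladder 3 (r - 1) (y + 5 / 2) *
      (ladder (-1) r (y + 2 * r + 1) * ladder (-1) (r - 1) (y + 2 * r + 2)) := by
    simp only [oddProd3]; ring_nf
  rw [e1, e3, oddProd2_shift, oddProd2]
  ring

theorem oddProd2_cross (r : ℕ) (y : ℂ) :
    (y + (3 * r + 4) / 2) * (oddProd2 (r + 1) y * oddProd2 r (y + 1)) =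
      (y + r + 3 / 2) * (evenProd2 (r + 1) y * evenProd2 (r + 1) (y + 1)) := by
  have h1 := ladder_three_cross_two (r + 1) (y + 3 / 2)
  have h2 := ladder_cross_one (-1) (r + 1) (y + 2 * r + 2)
  have hc := oddFactor_mul_evenFactor (r + 1) (y + (3 * r + 4) / 2)
  have e1 : evenProd2 (r + 1) (y + 1) =
      ladder (-1) (r + 1) (y + 2 * r + 3) * ladder (-1) (r - 1) (y + 2 * r + 3) *
        (ladder 3 r (y + 5 / 2) * ladder 3 r (y + 7 / 2)) := by
    rw [evenProd2_succ]; ring_nf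
  push_cast at h1 h2
  rw [show y + 3 / 2 + 3 * ((r : ℂ) + 1) / 2 - 1 = y + (3 * r + 4) / 2 by ring,
    show (r : ℤ) + 1 - 1 = r by ring,
    show (r : ℤ) + 1 - 2 = r - 1 by ring, show y + 3 / 2 + 2 = y + 7 / 2 by ring] at h1
  rw [show y + 2 * (r : ℂ) + 2 + -1 * ((r : ℂ) + 1 - 1) / 2 = y + (3 * r + 4) / 2 by ring,
    show (r : ℤ) + 1 - 1 = r by ring,
    show (r : ℤ) + 1 - 2 = r - 1 by ring,
    show y + 2 * (r : ℂ) + 2 + 1 = y + 2 * r + 3 by ring] at h2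
  rw [oddProd2_succ, oddProd2_shift, evenProd2_succ, e1, ← hc]
  generalize oddFactor (r + 1) (y + (3 * r + 4) / 2) = a at *
  generalize evenFactor (r + 1) (y + (3 * r + 4) / 2) = b at *
  linear_combination ladder (-1) (r + 1) (y + 2 * r + 3) * ladder (-1) (r - 1) (y + 2 * r + 2) *
    ladder 3 r (y + 5 / 2) ^ 2 *
    (b * (ladder 3 (r + 1) (y + 3 / 2) * ladder 3 (r - 1) (y + 7 / 2)) * h2 +
      ladder (-1) (r - 1) (y + 2 * r + 3) * ladder (-1) (r + 1) (y + 2 * r + 2) * h1)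

theorem evenProd1_mul_evenProd3 (r : ℕ) (y : ℂ) :
    evenProd1 (r + 1) (y + 1 / 2) * evenProd3 (r + 1) (y + 1 / 2) =
      oddProd2 (r + 1) y * oddProd2 r (y + 1) := by
  have e1 : evenProd1 (r + 1) (y + 1 / 2) =
      ladder 3 (r + 1) (y + 3 / 2) * ladder 3 (r - 1) (y + 7 / 2) *
        (ladder (-1) r (y + 2 * r + 3) * ladder (-1) r (y + 2 * r + 2)) := by
    rw [evenProd1_succ]; ring_nf
  have e3 : evenProd3 (r + 1) (y + 1 / 2) = ladder 3 r (y + 5 / 2) * ladder 3 r (y + 5 / 2) *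
      (ladder (-1) (r + 1) (y + 2 * r + 3) * ladder (-1) (r - 1) (y + 2 * r + 2)) := by
    rw [evenProd3_succ]; ring_nf
  rw [e1, e3, oddProd2_succ, oddProd2_shift]
  ring

theorem oddProd3_shift (r : ℕ) (y : ℂ) : oddProd3 r (y + 1) =
    ladder 3 r (y + 3) * ladder 3 (r - 1) (y + 3) *
      (ladder (-1) r (y + 2 * r + 3 / 2) * ladder (-1) (r - 1) (y + 2 * r + 5 / 2)) := by
  simp only [oddProd3]; ring_nf

/-- The two parities of `r` interchange the two factors on the right. -/
theorem half_factors (r : ℕ) (y : ℂ) :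
    (y + r + 1 + ((r + 1) / 2 : ℕ)) * (y + 2 * r + 3 / 2 - ((r + 1) / 2 : ℕ)) =
      (y + 3 * (r + 1) / 2) * (y + 3 * (r + 1) / 2 - 1 / 2) := by
  obtain ⟨k, hk | hk⟩ := Nat.even_or_odd' r
  · rw [show (r + 1) / 2 = k by omega, hk]
    push_cast
    ring
  · rw [show (r + 1) / 2 = k + 1 by omega, hk]
    push_cast
    ring

theorem ladder_three_cross_half (r : ℕ) (y : ℂ) :
    (y + r + 1 + ((r + 1) / 2 : ℕ)) * (ladder 3 r (y + 2) * ladder 3 (r - 1) (y + 3)) =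
      (y + r + 1) * (ladder 3 (r - 1) (y + 2) * ladder 3 r (y + 3)) := by
  have h := ladder_three_cross_one (r + 1) (y + 2)
  rw [show y + 2 + ((r + 1 : ℕ) : ℂ) - 2 = y + r + 1 by push_cast; ring,
    show ((r + 1 : ℕ) : ℤ) - 1 = r by push_cast; ring,
    show ((r + 1 : ℕ) : ℤ) - 2 = r - 1 by push_cast; ring, show y + 2 + 1 = y + 3 by ring] at h
  exact h

theorem evenProd3_cross (r : ℕ) (y : ℂ) :
    (y + 3 * (r + 1) / 2) * (y + 3 * (r + 1) / 2 - 1 / 2) *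
        (evenProd3 (r + 1) y * evenProd3 r (y + 1)) =
      (y + r + 1) * ((y + 3 * r + 5 / 2) * (y + 3 * r + 3 / 2)) *
        (oddProd3 r y * oddProd3 r (y + 1)) := by
  have h1 := ladder_three_cross_half r y
  have h2 := ladder_neg_one_cross_two r (y + 2 * r + 5 / 2)
  have e1 : evenProd3 r (y + 1) = ladder 3 (r - 1) (y + 3) * ladder 3 (r - 1) (y + 3) *
      (ladder (-1) r (y + 2 * r + 3 / 2) * ladder (-1) (r - 2) (y + 2 * r + 1 / 2)) := by
    simp only [evenProd3]; ring_nf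
  rw [show y + 2 * (r : ℂ) + 5 / 2 - 1 = y + 2 * r + 3 / 2 by ring,
    show y + 2 * (r : ℂ) + 5 / 2 - 2 = y + 2 * r + 1 / 2 by ring] at h2
  rw [evenProd3_succ, e1, oddProd3_shift, oddProd3, ← half_factors]
  generalize (((r + 1) / 2 : ℕ) : ℂ) = c at *
  linear_combination ladder 3 r (y + 2) * ladder 3 (r - 1) (y + 3) *
    ladder (-1) (r - 1) (y + 2 * r + 3 / 2) * ladder (-1) r (y + 2 * r + 3 / 2) *
    ((y + 2 * r + 3 / 2 - c) * ladder (-1) (r + 1) (y + 2 * r + 5 / 2) *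
      ladder (-1) (r - 2) (y + 2 * r + 1 / 2) * h1 +
    (y + r + 1) * (ladder 3 (r - 1) (y + 2) * ladder 3 r (y + 3)) * h2)

theorem oddProd2_sq (r : ℕ) (y : ℂ) :
    (y + 3 * (r + 1) / 2) * (y + 3 * (r + 1) / 2 - 1 / 2) * oddProd2 r (y + 1 / 2) ^ 2 =
      (y + r + 1) * (y + 2 * r + 3 / 2) * (oddProd3 r y * oddProd3 r (y + 1)) := by
  have h1 := ladder_three_cross_half r y
  have h2 := ladder_neg_one_cross_middle (r + 1) (y + 2 * r + 5 / 2)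
  have e2 : oddProd2 r (y + 1 / 2) =
      ladder (-1) r (y + 2 * r + 3 / 2) * ladder (-1) (r - 1) (y + 2 * r + 3 / 2) *
        (ladder 3 r (y + 2) * ladder 3 (r - 1) (y + 3)) := by
    simp only [oddProd2]; ring_nf
  rw [show y + 2 * (r : ℂ) + 5 / 2 - 1 = y + 2 * r + 3 / 2 by ring,
    show y + 2 * (r : ℂ) + 5 / 2 - 2 = y + 2 * r + 1 / 2 by ring,
    show ((r + 1 : ℕ) : ℤ) - 1 = r by push_cast; ring,
    show ((r + 1 : ℕ) : ℤ) - 2 = r - 1 by push_cast; ring] at h2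
  rw [e2, oddProd3_shift, oddProd3, ← half_factors]
  generalize (((r + 1) / 2 : ℕ) : ℂ) = c at *
  linear_combination ladder (-1) r (y + 2 * r + 3 / 2) *
    ladder (-1) (r - 1) (y + 2 * r + 3 / 2) * ladder 3 r (y + 2) * ladder 3 (r - 1) (y + 3) *
    ((y + 2 * r + 3 / 2 - c) * ladder (-1) r (y + 2 * r + 3 / 2) *
      ladder (-1) (r - 1) (y + 2 * r + 3 / 2) * h1 +
    (y + r + 1) * (ladder 3 (r - 1) (y + 2) * ladder 3 r (y + 3)) * h2)

theorem evenProd3_shift (r : ℕ) (y : ℂ) : evenProd3 (r + 1) (y + 1) =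
    ladder 3 r (y + 3) * ladder 3 r (y + 3) *
      (ladder (-1) (r + 1) (y + 2 * r + 7 / 2) * ladder (-1) (r - 1) (y + 2 * r + 5 / 2)) := by
  rw [evenProd3_succ]; ring_nf

theorem oddProd3_cross (r : ℕ) (y : ℂ) :
    (y + 3 * r + 7 / 2) * (oddProd3 (r + 1) y * oddProd3 r (y + 1)) =
      (y + (3 * r + 4) / 2) * (evenProd3 (r + 1) y * evenProd3 (r + 1) (y + 1)) := by
  have h1 := ladder_three_cross_one_succ r (y + 2)
  have h2 := ladder_neg_one_cross_shift_succ r (y + 2 * r + 5 / 2)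
  have hc := oddFactor_mul_evenFactor (r + 1) (y + (3 * r + 4) / 2)
  rw [show y + 2 + 3 * (r : ℂ) / 2 = y + (3 * r + 4) / 2 by ring,
    show y + 2 + 1 = y + 3 by ring] at h1
  rw [show y + 2 * (r : ℂ) + 5 / 2 - (r + 1) / 2 = y + (3 * r + 4) / 2 by ring,
    show y + 2 * (r : ℂ) + 5 / 2 + 1 = y + 2 * r + 7 / 2 by ring,
    show y + 2 * (r : ℂ) + 5 / 2 - 1 = y + 2 * r + 3 / 2 by ring] at h2
  rw [evenProd3_shift, evenProd3_succ, oddProd3_succ, oddProd3_shift, ← hc]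
  generalize oddFactor (r + 1) (y + (3 * r + 4) / 2) = a at *
  generalize evenFactor (r + 1) (y + (3 * r + 4) / 2) = b at *
  linear_combination -ladder 3 r (y + 2) * ladder 3 r (y + 3) *
    ladder (-1) (r + 1) (y + 2 * r + 5 / 2) * ladder (-1) (r - 1) (y + 2 * r + 5 / 2) *
    (b * (ladder (-1) (r + 1) (y + 2 * r + 7 / 2) * ladder (-1) (r - 1) (y + 2 * r + 3 / 2)) * h1 +
      ladder 3 (r - 1) (y + 3) * ladder 3 (r + 1) (y + 2) * h2)

theorem evenProd2_sq (r : ℕ) {y : ℂ} (hy : y.im ≠ 0) :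
    (y + 3 * r + 7 / 2) * evenProd2 (r + 1) (y + 1 / 2) ^ 2 =
      (y + 2 * r + 5 / 2) * (evenProd3 (r + 1) y * evenProd3 (r + 1) (y + 1)) := by
  have h1 := ladder_neg_one_cross_same_succ r (y + 2 * r + 5 / 2)
  have h2 := ladder_neg_one_cross_shift_succ r (y + 2 * r + 5 / 2)
  have e2 : evenProd2 (r + 1) (y + 1 / 2) =
      ladder (-1) (r + 1) (y + 2 * r + 5 / 2) * ladder (-1) (r - 1) (y + 2 * r + 5 / 2) *
        (ladder 3 r (y + 2) * ladder 3 r (y + 3)) := by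
    rw [evenProd2_succ]; ring_nf
  have hb : evenFactor (r + 1) (y + 2 * r + 5 / 2 - (r + 1) / 2) ≠ 0 := by
    unfold evenFactor
    split_ifs
    · rw [show y + 2 * (r : ℂ) + 5 / 2 - (r + 1) / 2 = y + ((2 * r + 5 / 2 - (r + 1) / 2 : ℝ) : ℂ)
        by push_cast; ring]
      exact fun h => hy (by simpa using congrArg Complex.im h)
    · exact one_ne_zero
  rw [show y + 2 * (r : ℂ) + 5 / 2 + 1 = y + 2 * r + 7 / 2 by ring,
    show y + 2 * (r : ℂ) + 5 / 2 - 1 = y + 2 * r + 3 / 2 by ring] at h1 h2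
  rw [e2, evenProd3_shift, evenProd3_succ]
  generalize evenFactor (r + 1) (y + 2 * r + 5 / 2 - (r + 1) / 2) = b at *
  refine mul_left_cancel₀ hb ?_
  linear_combination ladder 3 r (y + 2) ^ 2 * ladder 3 r (y + 3) ^ 2 *
    (ladder (-1) (r + 1) (y + 2 * r + 5 / 2) * ladder (-1) (r - 1) (y + 2 * r + 5 / 2)) *
    ((y + 3 * r + 7 / 2) * h1 - (y + 2 * r + 5 / 2) * h2)

/-! ### The numerical factors -/

theorem factQuot_succ (m N : ℕ) :
    factQuot (m + 1) N = factQuot m N * ((m.factorial : ℂ) / ((N - (m + 1)).factorial : ℂ)) := by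
  rw [factQuot, Finset.prod_Icc_succ_top (by omega), Nat.add_sub_cancel]
  rfl

/-- Raising `N` divides `factQuot m N` by `N (N - 1) ⋯ (N - m + 1)`. -/
theorem factQuot_mul_factorial {m N : ℕ} (h : m ≤ N) :
    factQuot m (N + 1) * (N.factorial : ℂ) = factQuot m N * ((N - m).factorial : ℂ) := by
  induction m with
  | zero => simp [factQuot]
  | succ m ih =>
    have ih' := ih (by omega)
    have h1 : ((N - m).factorial : ℂ) ≠ 0 := by exact_mod_cast (N - m).factorial_ne_zero
    have h2 : ((N - (m + 1)).factorial : ℂ) ≠ 0 := by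
      exact_mod_cast (N - (m + 1)).factorial_ne_zero
    rw [factQuot_succ, factQuot_succ, Nat.add_sub_add_right]
    field_simp
    linear_combination (m.factorial : ℂ) * ih'

theorem factQuot_ne_zero (m N : ℕ) : factQuot m N ≠ 0 :=
  Finset.prod_ne_zero_iff.2 fun i _ =>
    div_ne_zero (by exact_mod_cast (i - 1).factorial_ne_zero)
      (by exact_mod_cast (N - i).factorial_ne_zero)

/-- The rational factor common to the evaluations for all `k`. -/
noncomputable def weight (n : ℕ) : ℂ :=
  2 ^ ((n / 2) * ((n + 1) / 2)) * factQuot ((n + 1) / 2) n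

theorem weight_ne_zero (n : ℕ) : weight n ≠ 0 :=
  mul_ne_zero (pow_ne_zero _ two_ne_zero) (factQuot_ne_zero _ _)

theorem weight_even (r : ℕ) : weight (2 * r) = 2 ^ (r * r) * factQuot r (2 * r) := by
  rw [weight, show 2 * r / 2 = r by omega, show (2 * r + 1) / 2 = r by omega]

theorem weight_odd (r : ℕ) :
    weight (2 * r + 1) = 2 ^ (r * (r + 1)) * factQuot (r + 1) (2 * r + 1) := by
  rw [weight, show (2 * r + 1) / 2 = r by omega, show (2 * r + 1 + 1) / 2 = r + 1 by omega]

theorem weight_odd_mul (r : ℕ) :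
    weight (2 * r + 1) * ((2 * r).factorial : ℂ) = 2 ^ r * weight (2 * r) * (r.factorial : ℂ) := by
  have h := factQuot_mul_factorial (m := r) (N := 2 * r) (by omega)
  have h1 : (r.factorial : ℂ) ≠ 0 := by exact_mod_cast r.factorial_ne_zero
  rw [show 2 * r - r = r by omega] at h
  rw [weight_odd, weight_even, factQuot_succ, show 2 * r + 1 - (r + 1) = r by omega, div_self h1]
  rw [mul_add, pow_add, mul_one (r : ℕ)]
  linear_combination 2 ^ (r * r) * 2 ^ r * h

theorem weight_even_mul (r : ℕ) :
    weight (2 * r + 2) * ((2 * r + 1).factorial : ℂ) =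
      2 ^ (r + 1) * weight (2 * r + 1) * (r.factorial : ℂ) := by
  have h := factQuot_mul_factorial (m := r + 1) (N := 2 * r + 1) (by omega)
  rw [show 2 * r + 1 - (r + 1) = r by omega] at h
  rw [show 2 * r + 2 = 2 * (r + 1) by ring, weight_odd, weight_even,
    show 2 * (r + 1) = 2 * r + 1 + 1 by ring,
    show (r + 1) * (r + 1) = r * (r + 1) + (r + 1) by ring, pow_add]
  linear_combination 2 ^ (r * (r + 1)) * 2 ^ (r + 1) * h

theorem weight_even_cross (r : ℕ) :
    (2 * r + 1) * (weight (2 * r + 2) * weight (2 * r)) = 2 * weight (2 * r + 1) ^ 2 := by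
  have h1 := weight_even_mul r
  have h2 := weight_odd_mul r
  have f1 : (r.factorial : ℂ) ≠ 0 := by exact_mod_cast r.factorial_ne_zero
  have f2 : ((2 * r).factorial : ℂ) ≠ 0 := by exact_mod_cast (2 * r).factorial_ne_zero
  rw [Nat.factorial_succ] at h1
  push_cast at h1
  refine mul_left_cancel₀ (mul_ne_zero (mul_ne_zero f1 f2) (pow_ne_zero r two_ne_zero)) ?_
  rw [pow_succ] at h1
  linear_combination (r.factorial : ℂ) * 2 ^ r * weight (2 * r) * h1 -
    2 * weight (2 * r + 1) * (r.factorial : ℂ) * 2 ^ r * h2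

theorem weight_odd_cross (r : ℕ) :
    2 * (weight (2 * r + 3) * weight (2 * r + 1)) = weight (2 * r + 2) ^ 2 := by
  have h1 := weight_even_mul r
  have h2 := weight_odd_mul (r + 1)
  have f1 : (r.factorial : ℂ) ≠ 0 := by exact_mod_cast r.factorial_ne_zero
  have f2 : ((2 * r + 1).factorial : ℂ) ≠ 0 := by exact_mod_cast (2 * r + 1).factorial_ne_zero
  have f3 : (r : ℂ) + 1 ≠ 0 := by exact_mod_cast Nat.succ_ne_zero r
  rw [show 2 * (r + 1) + 1 = 2 * r + 3 by ring, show 2 * (r + 1) = 2 * r + 1 + 1 by ring,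
    Nat.factorial_succ (2 * r + 1), Nat.factorial_succ r] at h2
  push_cast at h2
  rw [show 2 * r + 1 + 1 = 2 * r + 2 by ring] at h2
  refine mul_left_cancel₀ (mul_ne_zero (mul_ne_zero (mul_ne_zero f1 f2)
    (pow_ne_zero (r + 1) two_ne_zero)) f3) ?_
  linear_combination (r.factorial : ℂ) * 2 ^ (r + 1) * weight (2 * r + 1) * h2 -
    weight (2 * r + 2) * (r.factorial : ℂ) * (r + 1) * 2 ^ (r + 1) * h1

/-! ### The evaluations away from the real axis -/

/-- The values of the determinants of even order `2 * r` for `k = 0, 1, 2, 3` and non-real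
arguments, where no factor of the products vanishes. -/
structure EvenEvaluation (q : ℂ) (r : ℕ) : Prop where
  zero : ∀ y : ℂ, y.im ≠ 0 →
    dDet (2 * r) 0 (2 * y) q = (1 + q) ^ r * (weight (2 * r) * evenProd0 r y)
  one : ∀ y : ℂ, y.im ≠ 0 → dDet (2 * r) 1 (2 * y) q = weight (2 * r) * evenProd1 r y
  two : ∀ y : ℂ, y.im ≠ 0 →
    dDet (2 * r) 2 (2 * y) q = (-q) ^ r * (weight (2 * r) * evenProd2 r y)
  three : ∀ y : ℂ, y.im ≠ 0 →
    dDet (2 * r) 3 (2 * y) q = ((-q) ^ r) ^ 2 * (weight (2 * r) * evenProd3 r y)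

/-- The values of the determinants of odd order `2 * r + 1` for `k = 1, 2, 3` and non-real
arguments, where no factor of the products vanishes. -/
structure OddEvaluation (q : ℂ) (r : ℕ) : Prop where
  one : ∀ y : ℂ, y.im ≠ 0 → dDet (2 * r + 1) 1 (2 * y) q = weight (2 * r + 1) * oddProd1 r y
  two : ∀ y : ℂ, y.im ≠ 0 →
    dDet (2 * r + 1) 2 (2 * y) q = (-q) ^ r * (1 - q) * (weight (2 * r + 1) * oddProd2 r y)
  three : ∀ y : ℂ, y.im ≠ 0 →
    dDet (2 * r + 1) 3 (2 * y) q =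
      ((-q) ^ r) ^ 2 * (-2 * q) * (weight (2 * r + 1) * oddProd3 r y)

theorem evenProd0_ne_zero (p : ℕ) {y : ℂ} (hy : y.im ≠ 0) : evenProd0 p y ≠ 0 := by
  refine mul_ne_zero (mul_ne_zero ?_ ?_) (pow_ne_zero _ ?_) <;>
    exact ladder_ne_zero (by simp) (by simpa using hy) _

theorem evenProd1_ne_zero (p : ℕ) {y : ℂ} (hy : y.im ≠ 0) : evenProd1 p y ≠ 0 := by
  refine mul_ne_zero (mul_ne_zero ?_ ?_) (mul_ne_zero ?_ ?_) <;>
    exact ladder_ne_zero (by simp) (by simpa using hy) _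

theorem evenProd2_ne_zero (p : ℕ) {y : ℂ} (hy : y.im ≠ 0) : evenProd2 p y ≠ 0 := by
  refine mul_ne_zero (mul_ne_zero ?_ ?_) (mul_ne_zero ?_ ?_) <;>
    exact ladder_ne_zero (by simp) (by simpa using hy) _

theorem evenProd3_ne_zero (p : ℕ) {y : ℂ} (hy : y.im ≠ 0) : evenProd3 p y ≠ 0 := by
  refine mul_ne_zero (mul_ne_zero ?_ ?_) (mul_ne_zero ?_ ?_) <;>
    exact ladder_ne_zero (by simp) (by simpa using hy) _

theorem oddProd1_ne_zero (p : ℕ) {y : ℂ} (hy : y.im ≠ 0) : oddProd1 p y ≠ 0 := by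
  refine mul_ne_zero (mul_ne_zero ?_ ?_) (mul_ne_zero ?_ ?_) <;>
    exact ladder_ne_zero (by simp) (by simpa using hy) _

theorem oddProd2_ne_zero (p : ℕ) {y : ℂ} (hy : y.im ≠ 0) : oddProd2 p y ≠ 0 := by
  refine mul_ne_zero (mul_ne_zero ?_ ?_) (mul_ne_zero ?_ ?_) <;>
    exact ladder_ne_zero (by simp) (by simpa using hy) _

theorem oddProd3_ne_zero (p : ℕ) {y : ℂ} (hy : y.im ≠ 0) : oddProd3 p y ≠ 0 := by
  refine mul_ne_zero (mul_ne_zero ?_ ?_) (mul_ne_zero ?_ ?_) <;>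
    exact ladder_ne_zero (by simp) (by simpa using hy) _

theorem add_ne_zero_of_im {y c : ℂ} (hy : y.im ≠ 0) (hc : c.im = 0) : y + c ≠ 0 := fun h =>
  hy (by simpa [hc] using congrArg Complex.im h)

theorem ne_zero_of_sq_add_self_add_one {q : ℂ} (hq : q ^ 2 + q + 1 = 0) : q ≠ 0 := by
  rintro rfl
  norm_num at hq

theorem one_sub_ne_zero_of_sq_add_self_add_one {q : ℂ} (hq : q ^ 2 + q + 1 = 0) : 1 - q ≠ 0 := by
  intro h
  rw [← sub_eq_zero.1 h] at hq
  norm_num at hq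

theorem one_add_ne_zero_of_sq_add_self_add_one {q : ℂ} (hq : q ^ 2 + q + 1 = 0) : 1 + q ≠ 0 := by
  intro h
  rw [show q = -1 by linear_combination h] at hq
  norm_num at hq

theorem neg_inv_of_sq_add_self_add_one {q : ℂ} (hq : q ^ 2 + q + 1 = 0) : (-q)⁻¹ = 1 + q :=
  inv_eq_of_mul_eq_one_right (by linear_combination -hq)

/-- The case `k = 0` of `dDet_neg` says that the matrix is skew-symmetric up to factors of rows and
columns. -/
theorem dDet_odd_zero_of_im (r : ℕ) {x q : ℂ} (hx : x.im ≠ 0) (hq : q ≠ 0) :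
    dDet (2 * r + 1) 0 x q = 0 := by
  have h := dDet_neg (2 * r + 1) 0 hx hq
  rw [neg_zero, zpow_zero, Odd.neg_one_pow ⟨r, rfl⟩] at h
  linear_combination h / 2

theorem dDet_neg_one_of_im (n : ℕ) {x q : ℂ} (hx : x.im ≠ 0) (hq : q ^ 2 + q + 1 = 0) :
    dDet n (-1) x q = (-(1 + q)) ^ n * dDet n 1 x q := by
  rw [dDet_neg n 1 hx (ne_zero_of_sq_add_self_add_one hq), zpow_neg_one,
    neg_inv_of_sq_add_self_add_one hq]

/-- `4` and `-2` are congruent modulo `6`, and `dDet_neg` relates `-2` to `2`. -/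
theorem dDet_four_of_im (n : ℕ) {x q : ℂ} (hx : x.im ≠ 0) (hq : q ^ 2 + q + 1 = 0) :
    dDet n 4 x q = (-q) ^ n * dDet n 2 x q := by
  have h := dDet_add_six_mul n 4 (-1) x (q := q) (by linear_combination (q - 1) * hq)
  have h2 : -(-q) ^ (-2 : ℤ) = -q := by
    rw [show (-2 : ℤ) = -1 + -1 by norm_num,
      zpow_add₀ (neg_ne_zero.2 (ne_zero_of_sq_add_self_add_one hq)), zpow_neg_one,
      neg_inv_of_sq_add_self_add_one hq]
    linear_combination -hq
  rw [← h, show (6 : ℤ) * -1 + 4 = -2 by norm_num,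
    dDet_neg n 2 hx (ne_zero_of_sq_add_self_add_one hq), h2]

/-- The condensation recurrence in terms of `y = x / 2`. -/
theorem dDet_two_mul_condensation (m : ℕ) (k : ℤ) {y : ℂ} (q : ℂ) (hy : y.im ≠ 0)
    (h : dDet m k (2 * (y + 1)) q ≠ 0) :
    ((m : ℂ) + 1) * (dDet (m + 2) k (2 * y) q * dDet m k (2 * (y + 1)) q) =
      (2 * y + m + 2) * (dDet (m + 1) k (2 * y) q * dDet (m + 1) k (2 * (y + 1)) q) -
      (2 * y + 1) * (dDet (m + 1) (k - 1) (2 * (y + 1 / 2)) q *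
        dDet (m + 1) (k + 1) (2 * (y + 1 / 2)) q) := by
  have e1 : 2 * (y + 1) = 2 * y + 2 := by ring
  have e2 : 2 * (y + 1 / 2) = 2 * y + 1 := by ring
  rw [e1] at h
  rw [e1, e2]
  exact dDet_condensation m k q (by simpa using hy) h

theorem EvenEvaluation.init (q : ℂ) : EvenEvaluation q 0 := by
  constructor <;> intro y _ <;>
    simp [dDet, weight, factQuot, evenProd0, evenProd1, evenProd2, evenProd3, ladder_of_nonpos]

theorem OddEvaluation.init {q : ℂ} (hq : q ^ 2 + q + 1 = 0) : OddEvaluation q 0 := by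
  have h := one_add_ne_zero_of_sq_add_self_add_one hq
  constructor <;> intro y _ <;>
    simp [dDet, weight, factQuot, oddProd1, oddProd2, oddProd3, ladder_of_nonpos] <;>
    field_simp
  · norm_cast
  · norm_cast
    ring
  · norm_cast
    linear_combination (q + 1) * hq

/-- The condensation recurrence from the orders `2 * r` and `2 * r + 1` to `2 * r + 2`. -/
theorem EvenEvaluation.succ {q : ℂ} (hq : q ^ 2 + q + 1 = 0) {r : ℕ} (hE : EvenEvaluation q r)
    (hO : OddEvaluation q r) : EvenEvaluation q (r + 1) := by
  have hq0 := ne_zero_of_sq_add_self_add_one hq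
  have hw := weight_ne_zero (2 * r)
  have hr : 2 * (r : ℂ) + 1 ≠ 0 := by exact_mod_cast Nat.succ_ne_zero (2 * r)
  have hwc := weight_even_cross r
  have ha : (-q) ^ r ≠ 0 := pow_ne_zero _ (neg_ne_zero.2 hq0)
  have im1 : ∀ {y : ℂ}, y.im ≠ 0 → (y + 1).im ≠ 0 := fun h => by simpa using h
  have imh : ∀ {y : ℂ}, y.im ≠ 0 → (y + 1 / 2).im ≠ 0 := fun h => by simpa using h
  have im2 : ∀ {y : ℂ}, y.im ≠ 0 → (2 * y).im ≠ 0 := fun h => by simpa using h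
  constructor <;> intro y hy
  -- For `k = 0` the determinants of odd order vanish, so only the term with `k = ± 1` is left.
  · have h0 : dDet (2 * r) 0 (2 * (y + 1)) q ≠ 0 := by
      rw [hE.zero _ (im1 hy)]
      exact mul_ne_zero (pow_ne_zero _ (one_add_ne_zero_of_sq_add_self_add_one hq))
        (mul_ne_zero hw (evenProd0_ne_zero r (im1 hy)))
    have key := dDet_two_mul_condensation (2 * r) 0 q hy h0
    refine mul_right_cancel₀ h0 (mul_left_cancel₀ hr ?_)
    rw [zero_sub, zero_add, dDet_neg_one_of_im _ (im2 (imh hy)) hq,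
      dDet_odd_zero_of_im r (im2 hy) hq0, hO.one _ (imh hy), hE.zero _ (im1 hy),
      Odd.neg_pow ⟨r, rfl⟩] at key
    rw [hE.zero _ (im1 hy), show 2 * (r + 1) = 2 * r + 2 by ring]
    push_cast at key
    linear_combination key - (1 + q) ^ (2 * r + 1) * (evenProd0 (r + 1) y * evenProd0 r (y + 1) *
      hwc + 2 * weight (2 * r + 1) ^ 2 * evenProd0_cross r y)
  -- For `k = 1` the second term contains a vanishing determinant of odd order with `k = 0`.
  · have h0 : dDet (2 * r) 1 (2 * (y + 1)) q ≠ 0 := by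
      rw [hE.one _ (im1 hy)]
      exact mul_ne_zero hw (evenProd1_ne_zero r (im1 hy))
    have key := dDet_two_mul_condensation (2 * r) 1 q hy h0
    refine mul_right_cancel₀ h0 (mul_left_cancel₀ hr ?_)
    rw [sub_self, dDet_odd_zero_of_im r (im2 (imh hy)) hq0, hO.one _ hy, hO.one _ (im1 hy),
      hE.one _ (im1 hy)] at key
    rw [hE.one _ (im1 hy), show 2 * (r + 1) = 2 * r + 2 by ring]
    push_cast at key
    linear_combination key - (evenProd1 (r + 1) y * evenProd1 r (y + 1) *
      hwc + 2 * weight (2 * r + 1) ^ 2 * evenProd1_cross r y)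
  · have h0 : dDet (2 * r) 2 (2 * (y + 1)) q ≠ 0 := by
      rw [hE.two _ (im1 hy)]
      exact mul_ne_zero ha (mul_ne_zero hw (evenProd2_ne_zero r (im1 hy)))
    have key := dDet_two_mul_condensation (2 * r) 2 q hy h0
    refine mul_right_cancel₀ h0 (mul_left_cancel₀ hr ?_)
    rw [show (2 : ℤ) - 1 = 1 by norm_num, show (2 : ℤ) + 1 = 3 by norm_num, hO.one _ (imh hy),
      hO.two _ hy, hO.two _ (im1 hy), hO.three _ (imh hy), hE.two _ (im1 hy)] at key
    rw [hE.two _ (im1 hy), show 2 * (r + 1) = 2 * r + 2 by ring, pow_succ]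
    push_cast at key
    generalize (-q) ^ r = a at *
    linear_combination key + a ^ 2 * q * (evenProd2 (r + 1) y * evenProd2 r (y + 1) *
      hwc + 2 * weight (2 * r + 1) ^ 2 * evenProd2_cross r y) +
      a ^ 2 * q * 2 * weight (2 * r + 1) ^ 2 * (2 * y + 1) * oddProd1_mul_oddProd3 r y +
      a ^ 2 * weight (2 * r + 1) ^ 2 * (2 * y + 2 * r + 2) *
        (oddProd2 r y * oddProd2 r (y + 1)) * hq
  · have h0 : dDet (2 * r) 3 (2 * (y + 1)) q ≠ 0 := by
      rw [hE.three _ (im1 hy)]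
      exact mul_ne_zero (pow_ne_zero _ ha) (mul_ne_zero hw (evenProd3_ne_zero r (im1 hy)))
    have key := dDet_two_mul_condensation (2 * r) 3 q hy h0
    have hu : y + 3 * ((r : ℂ) + 1) / 2 ≠ 0 := add_ne_zero_of_im hy (by simp)
    have hv : y + 3 * ((r : ℂ) + 1) / 2 - 1 / 2 ≠ 0 := by
      rw [add_sub_assoc]
      exact add_ne_zero_of_im hy (by simp)
    refine mul_right_cancel₀ h0 (mul_left_cancel₀ hr (mul_left_cancel₀ (mul_ne_zero hu hv) ?_))
    rw [show (3 : ℤ) - 1 = 2 by norm_num, show (3 : ℤ) + 1 = 4 by norm_num,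
      dDet_four_of_im _ (im2 (imh hy)) hq, hO.two _ (imh hy),
      hO.three _ hy, hO.three _ (im1 hy), hE.three _ (im1 hy)] at key
    rw [hE.three _ (im1 hy), show 2 * (r + 1) = 2 * r + 2 by ring, pow_succ (-q) r]
    push_cast at key
    have ha2 : (-q) ^ (2 * r + 1) = ((-q) ^ r) ^ 2 * -q := by
      rw [pow_succ, pow_mul']
    rw [ha2] at key
    generalize (-q) ^ r = a at *
    have c1 := evenProd3_cross r y
    have c2 := oddProd2_sq r y
    linear_combination (y + 3 * ((r : ℂ) + 1) / 2) * (y + 3 * ((r : ℂ) + 1) / 2 - 1 / 2) * key +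
      a ^ 4 * weight (2 * r + 1) ^ 2 * (2 * y + 1) * q * oddProd2 r (y + 1 / 2) ^ 2 *
        ((y + 3 * ((r : ℂ) + 1) / 2) * (y + 3 * ((r : ℂ) + 1) / 2 - 1 / 2)) * hq -
      a ^ 4 * weight (2 * r + 1) ^ 2 * q ^ 2 * 3 * (2 * y + 1) * c2 -
      a ^ 4 * q ^ 2 * (evenProd3 (r + 1) y * evenProd3 r (y + 1)) *
        ((y + 3 * ((r : ℂ) + 1) / 2) * (y + 3 * ((r : ℂ) + 1) / 2 - 1 / 2)) * hwc -
      2 * a ^ 4 * q ^ 2 * weight (2 * r + 1) ^ 2 * c1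

/-- The condensation recurrence from the orders `2 * r + 1` and `2 * r + 2` to `2 * r + 3`. -/
theorem OddEvaluation.succ {q : ℂ} (hq : q ^ 2 + q + 1 = 0) {r : ℕ}
    (hE : EvenEvaluation q (r + 1)) (hO : OddEvaluation q r) : OddEvaluation q (r + 1) := by
  have hq0 := ne_zero_of_sq_add_self_add_one hq
  have hq1 := one_sub_ne_zero_of_sq_add_self_add_one hq
  have hw := weight_ne_zero (2 * r + 1)
  have hr : 2 * ((r : ℂ) + 1) ≠ 0 := by exact_mod_cast Nat.succ_ne_zero (2 * r + 1)
  have hwc := weight_odd_cross r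
  have ha : (-q) ^ r ≠ 0 := pow_ne_zero _ (neg_ne_zero.2 hq0)
  have hb : (1 + q) ^ r * (-q) ^ r = 1 := by
    rw [← mul_pow, show (1 + q) * -q = 1 by linear_combination -hq, one_pow]
  have im1 : ∀ {y : ℂ}, y.im ≠ 0 → (y + 1).im ≠ 0 := fun h => by simpa using h
  have imh : ∀ {y : ℂ}, y.im ≠ 0 → (y + 1 / 2).im ≠ 0 := fun h => by simpa using h
  have im2 : ∀ {y : ℂ}, y.im ≠ 0 → (2 * y).im ≠ 0 := fun h => by simpa using h
  have ev : 2 * r + 1 + 1 = 2 * (r + 1) := by ring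
  have od : 2 * (r + 1) + 1 = 2 * r + 1 + 2 := by ring
  constructor <;> intro y hy
  · have h0 : dDet (2 * r + 1) 1 (2 * (y + 1)) q ≠ 0 := by
      rw [hO.one _ (im1 hy)]
      exact mul_ne_zero hw (oddProd1_ne_zero r (im1 hy))
    have key := dDet_two_mul_condensation (2 * r + 1) 1 q hy h0
    have he : y + (3 * (r : ℂ) + 4) / 2 ≠ 0 := add_ne_zero_of_im hy (by simp)
    refine mul_right_cancel₀ h0 (mul_left_cancel₀ hr (mul_left_cancel₀ he ?_))
    rw [ev, sub_self, one_add_one_eq_two, hE.one _ hy, hE.one _ (im1 hy), hE.zero _ (imh hy),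
      hE.two _ (imh hy), hO.one _ (im1 hy), pow_succ, pow_succ] at key
    rw [hO.one _ (im1 hy), od]
    have c1 := oddProd1_cross r y
    have c2 := evenProd0_mul_evenProd2 r y
    rw [show 2 * r + 1 + 2 = 2 * r + 3 by ring] at *
    rw [show 2 * (r + 1) = 2 * r + 2 by ring] at *
    push_cast at key
    generalize (-q) ^ r = a at *
    generalize (1 + q) ^ r = b at *
    linear_combination (y + (3 * (r : ℂ) + 4) / 2) * key -
      (2 * y + 1) * (y + (3 * (r : ℂ) + 4) / 2) * weight (2 * r + 2) ^ 2 *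
        (evenProd0 (r + 1) (y + 1 / 2) * evenProd2 (r + 1) (y + 1 / 2)) *
        ((1 + q) * -q * hb - hq) -
      (2 * y + 1) * weight (2 * r + 2) ^ 2 * c2 -
      ((r : ℂ) + 1) * (y + (3 * (r : ℂ) + 4) / 2) * (oddProd1 (r + 1) y * oddProd1 r (y + 1)) *
        hwc - ((r : ℂ) + 1) * weight (2 * r + 2) ^ 2 * c1
  · have h0 : dDet (2 * r + 1) 2 (2 * (y + 1)) q ≠ 0 := by
      rw [hO.two _ (im1 hy)]
      exact mul_ne_zero (mul_ne_zero ha hq1) (mul_ne_zero hw (oddProd2_ne_zero r (im1 hy)))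
    have key := dDet_two_mul_condensation (2 * r + 1) 2 q hy h0
    refine mul_right_cancel₀ h0 (mul_left_cancel₀ hr ?_)
    rw [ev, show (2 : ℤ) - 1 = 1 by norm_num, show (2 : ℤ) + 1 = 3 by norm_num, hE.two _ hy,
      hE.two _ (im1 hy), hE.one _ (imh hy), hE.three _ (imh hy), hO.two _ (im1 hy),
      pow_succ (-q) r] at key
    rw [hO.two _ (im1 hy), od, pow_succ (-q) r]
    have c1 := oddProd2_cross r y
    have c3 := evenProd1_mul_evenProd3 r y
    rw [show 2 * r + 1 + 2 = 2 * r + 3 by ring] at *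
    rw [show 2 * (r + 1) = 2 * r + 2 by ring] at *
    push_cast at key
    generalize (-q) ^ r = a at *
    linear_combination key - 2 * a ^ 2 * q ^ 2 * weight (2 * r + 2) ^ 2 * c1 -
      a ^ 2 * q ^ 2 * weight (2 * r + 2) ^ 2 * (2 * y + 1) * c3 -
      ((r : ℂ) + 1) * a ^ 2 * -q * (1 - q) ^ 2 * (oddProd2 (r + 1) y * oddProd2 r (y + 1)) * hwc +
      ((r : ℂ) + 1) * a ^ 2 * q * (oddProd2 (r + 1) y * oddProd2 r (y + 1)) *
        weight (2 * r + 2) ^ 2 * hq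
  · have h0 : dDet (2 * r + 1) 3 (2 * (y + 1)) q ≠ 0 := by
      rw [hO.three _ (im1 hy)]
      exact mul_ne_zero (mul_ne_zero (pow_ne_zero _ ha) (mul_ne_zero (by norm_num) hq0))
        (mul_ne_zero hw (oddProd3_ne_zero r (im1 hy)))
    have key := dDet_two_mul_condensation (2 * r + 1) 3 q hy h0
    have he : y + 3 * (r : ℂ) + 7 / 2 ≠ 0 := by
      rw [add_assoc]
      exact add_ne_zero_of_im hy (by simp)
    refine mul_right_cancel₀ h0 (mul_left_cancel₀ hr (mul_left_cancel₀ he ?_))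
    rw [ev, show (3 : ℤ) - 1 = 2 by norm_num, show (3 : ℤ) + 1 = 4 by norm_num,
      dDet_four_of_im _ (im2 (imh hy)) hq, hE.three _ hy, hE.three _ (im1 hy), hE.two _ (imh hy),
      hO.three _ (im1 hy), pow_mul' (-q) 2 (r + 1), pow_succ (-q) r] at key
    rw [hO.three _ (im1 hy), od, pow_succ (-q) r]
    have c1 := oddProd3_cross r y
    have c2 := evenProd2_sq r hy
    rw [show 2 * r + 1 + 2 = 2 * r + 3 by ring] at *
    rw [show 2 * (r + 1) = 2 * r + 2 by ring] at *
    push_cast at key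
    generalize (-q) ^ r = a at *
    linear_combination (y + 3 * (r : ℂ) + 7 / 2) * key -
      a ^ 4 * q ^ 4 * weight (2 * r + 2) ^ 2 * (2 * y + 1) * c2 -
      4 * ((r : ℂ) + 1) * a ^ 4 * q ^ 4 * (y + 3 * (r : ℂ) + 7 / 2) *
        (oddProd3 (r + 1) y * oddProd3 r (y + 1)) * hwc -
      4 * ((r : ℂ) + 1) * a ^ 4 * q ^ 4 * weight (2 * r + 2) ^ 2 * c1

theorem evenEvaluation_and_oddEvaluation {q : ℂ} (hq : q ^ 2 + q + 1 = 0) (r : ℕ) :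
    EvenEvaluation q r ∧ OddEvaluation q r := by
  induction r with
  | zero => exact ⟨.init q, .init hq⟩
  | succ r ih =>
    have h := EvenEvaluation.succ hq ih.1 ih.2
    exact ⟨h, OddEvaluation.succ hq h ih.2⟩

/-! ### Extension to all arguments -/

theorem continuous_poch {f : ℂ → ℂ} (hf : Continuous f) (j : ℤ) :
    Continuous fun x => poch (f x) j :=
  (Polynomial.continuous _).comp hf

theorem continuous_ladder (s : ℂ) (M : ℤ) {f : ℂ → ℂ} (hf : Continuous f) :
    Continuous fun x => ladder s M (f x) := by
  simp only [fun x => ladder_eq_prod_range s M (f x) (Int.self_le_toNat M)]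
  exact continuous_finsetProd _ fun i _ => continuous_poch (hf.add continuous_const) _

theorem continuous_dDet (n : ℕ) (k : ℤ) (q : ℂ) : Continuous fun x => dDet n k x q := by
  simp only [dDet_eq_det_dEntry]
  refine Continuous.matrix_det (continuous_matrix fun i j => ?_)
  exact ((continuous_poch (by fun_prop) _).div_const _).mul_const _

/-- Two continuous functions that agree away from the real axis are equal. -/
theorem eq_of_eq_of_im_ne_zero {f g : ℂ → ℂ} (hf : Continuous f) (hg : Continuous g)
    (h : ∀ x : ℂ, x.im ≠ 0 → f x = g x) (x : ℂ) : f x = g x := by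
  have hd : Dense {x : ℂ | x.im ≠ 0} :=
    (dense_compl_singleton (0 : ℝ)).preimage Complex.isOpenMap_im
  exact congrFun (Continuous.ext_on hd hf hg h) x

theorem eq_of_two_mul {d f : ℂ → ℂ} (hd : Continuous d) (hf : Continuous f)
    (h : ∀ y : ℂ, y.im ≠ 0 → d (2 * y) = f y) (x : ℂ) : d x = f (x / 2) := by
  refine eq_of_eq_of_im_ne_zero hd (hf.comp (by fun_prop : Continuous fun x : ℂ => x / 2))
    (fun x hx => ?_) x
  have := h (x / 2) (by simpa using hx)
  rwa [mul_div_cancel₀ x two_ne_zero] at this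

section

variable {q : ℂ} (r : ℕ) (x : ℂ)

theorem dDet_even_zero (hq : q ^ 2 + q + 1 = 0) :
    dDet (2 * r) 0 x q = (1 + q) ^ r * (weight (2 * r) * evenProd0 r (x / 2)) := by
  refine eq_of_two_mul (f := fun y => (1 + q) ^ r * (weight (2 * r) * evenProd0 r y))
    (continuous_dDet _ _ q) ?_ (evenEvaluation_and_oddEvaluation hq r).1.zero x
  refine continuous_const.mul (continuous_const.mul (.mul (.mul ?_ ?_) (.pow ?_ 2))) <;>
    exact continuous_ladder _ _ (by fun_prop)

theorem dDet_even_one (hq : q ^ 2 + q + 1 = 0) :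
    dDet (2 * r) 1 x q = weight (2 * r) * evenProd1 r (x / 2) := by
  refine eq_of_two_mul (f := fun y => weight (2 * r) * evenProd1 r y)
    (continuous_dDet _ _ q) ?_ (evenEvaluation_and_oddEvaluation hq r).1.one x
  refine continuous_const.mul (.mul (.mul ?_ ?_) (.mul ?_ ?_)) <;>
    exact continuous_ladder _ _ (by fun_prop)

theorem dDet_even_two (hq : q ^ 2 + q + 1 = 0) :
    dDet (2 * r) 2 x q = (-q) ^ r * (weight (2 * r) * evenProd2 r (x / 2)) := by
  refine eq_of_two_mul (f := fun y => (-q) ^ r * (weight (2 * r) * evenProd2 r y))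
    (continuous_dDet _ _ q) ?_ (evenEvaluation_and_oddEvaluation hq r).1.two x
  refine continuous_const.mul (continuous_const.mul (.mul (.mul ?_ ?_) (.mul ?_ ?_))) <;>
    exact continuous_ladder _ _ (by fun_prop)

theorem dDet_even_three (hq : q ^ 2 + q + 1 = 0) :
    dDet (2 * r) 3 x q = ((-q) ^ r) ^ 2 * (weight (2 * r) * evenProd3 r (x / 2)) := by
  refine eq_of_two_mul (f := fun y => ((-q) ^ r) ^ 2 * (weight (2 * r) * evenProd3 r y))
    (continuous_dDet _ _ q) ?_ (evenEvaluation_and_oddEvaluation hq r).1.three x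
  refine continuous_const.mul (continuous_const.mul (.mul (.mul ?_ ?_) (.mul ?_ ?_))) <;>
    exact continuous_ladder _ _ (by fun_prop)

theorem dDet_odd_one (hq : q ^ 2 + q + 1 = 0) :
    dDet (2 * r + 1) 1 x q = weight (2 * r + 1) * oddProd1 r (x / 2) := by
  refine eq_of_two_mul (f := fun y => weight (2 * r + 1) * oddProd1 r y)
    (continuous_dDet _ _ q) ?_ (evenEvaluation_and_oddEvaluation hq r).2.one x
  refine continuous_const.mul (.mul (.mul ?_ ?_) (.mul ?_ ?_)) <;>
    exact continuous_ladder _ _ (by fun_prop)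

theorem dDet_odd_two (hq : q ^ 2 + q + 1 = 0) :
    dDet (2 * r + 1) 2 x q =
      (-q) ^ r * (1 - q) * (weight (2 * r + 1) * oddProd2 r (x / 2)) := by
  refine eq_of_two_mul
    (f := fun y => (-q) ^ r * (1 - q) * (weight (2 * r + 1) * oddProd2 r y))
    (continuous_dDet _ _ q) ?_ (evenEvaluation_and_oddEvaluation hq r).2.two x
  refine continuous_const.mul (continuous_const.mul (.mul (.mul ?_ ?_) (.mul ?_ ?_))) <;>
    exact continuous_ladder _ _ (by fun_prop)

theorem dDet_odd_three (hq : q ^ 2 + q + 1 = 0) :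
    dDet (2 * r + 1) 3 x q =
      ((-q) ^ r) ^ 2 * (-2 * q) * (weight (2 * r + 1) * oddProd3 r (x / 2)) := by
  refine eq_of_two_mul
    (f := fun y => ((-q) ^ r) ^ 2 * (-2 * q) * (weight (2 * r + 1) * oddProd3 r y))
    (continuous_dDet _ _ q) ?_ (evenEvaluation_and_oddEvaluation hq r).2.three x
  refine continuous_const.mul (continuous_const.mul (.mul (.mul ?_ ?_) (.mul ?_ ?_))) <;>
    exact continuous_ladder _ _ (by fun_prop)

theorem dDet_odd_zero (hq : q ≠ 0) : dDet (2 * r + 1) 0 x q = 0 :=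
  eq_of_eq_of_im_ne_zero (continuous_dDet _ _ q) continuous_const
    (fun _ hx => dDet_odd_zero_of_im r hx hq) x

theorem dDet_neg_one (hq : q ^ 2 + q + 1 = 0) :
    dDet r (-1) x q = (-(1 + q)) ^ r * dDet r 1 x q :=
  eq_of_eq_of_im_ne_zero (continuous_dDet _ _ q) ((continuous_dDet _ _ q).const_mul _)
    (fun _ hx => dDet_neg_one_of_im r hx hq) x

theorem dDet_four (hq : q ^ 2 + q + 1 = 0) : dDet r 4 x q = (-q) ^ r * dDet r 2 x q :=
  eq_of_eq_of_im_ne_zero (continuous_dDet _ _ q) ((continuous_dDet _ _ q).const_mul _)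
    (fun _ hx => dDet_four_of_im r hx hq) x

end

/-! ### Powers of a primitive third root of unity -/

theorem IsPrimitiveRoot.sq_add_self_add_one {q : ℂ} (hq : IsPrimitiveRoot q 3) :
    q ^ 2 + q + 1 = 0 := by
  have h := hq.geom_sum_eq_zero (by norm_num)
  simp [Finset.sum_range_succ] at h
  linear_combination h

/-- The principal square root of `q` is `1 + q`, the root with real part `1 / 2`. -/
theorem cpow_half_of_sq_add_self_add_one {q : ℂ} (hq : q ^ 2 + q + 1 = 0) :
    q ^ ((2 : ℕ) : ℂ)⁻¹ = 1 + q := by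
  have hre : 0 < (1 + q).re := by
    have h1 := congrArg Complex.re hq
    have h2 := congrArg Complex.im hq
    simp [pow_two] at h1 h2
    have h3 : q.im * (2 * q.re + 1) = 0 := by linear_combination h2
    rcases mul_eq_zero.1 h3 with h | h
    · rw [h] at h1
      nlinarith [sq_nonneg (q.re + 1 / 2)]
    · simp
      linarith
  have harg := abs_lt.1 (Complex.abs_arg_lt_pi_div_two_iff.2 (.inl hre))
  have h := Complex.pow_cpow_nat_inv (x := 1 + q) (n := 2) two_ne_zero
    (by simpa using harg.1) (by simpa using harg.2.le)
  rwa [show (1 + q) ^ 2 = q by linear_combination hq] at h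

theorem cpow_natCast_div_two {q : ℂ} (hq : q ^ 2 + q + 1 = 0) (n : ℕ) :
    q ^ ((n : ℂ) / 2) = (1 + q) ^ n := by
  rw [← cpow_half_of_sq_add_self_add_one hq, ← Complex.cpow_nat_mul]
  congr 1

theorem cpow_neg_natCast_div_two {q : ℂ} (hq : q ^ 2 + q + 1 = 0) (n : ℕ) :
    q ^ (-(n : ℂ) / 2) = (-q) ^ n := by
  rw [neg_div, Complex.cpow_neg, cpow_natCast_div_two hq, ← inv_pow,
    ← neg_inv_of_sq_add_self_add_one hq, inv_inv]

/-! ### Products over all indices as ladders -/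

theorem finprod_poch_mul {a b : ℕ → ℂ} {m n : ℕ → ℤ} {s t z w : ℂ} {M N : ℤ}
    (ha : ∀ i : ℕ, a i = z + s * i) (hm : ∀ i : ℕ, m i = M - 2 * i)
    (hb : ∀ i : ℕ, b i = w + t * i) (hn : ∀ i : ℕ, n i = N - 2 * i) :
    ∏ᶠ i : ℕ, poch (a i) (m i) * poch (b i) (n i) = ladder s M z * ladder t N w := by
  simp only [ha, hm, hb, hn]
  exact finprod_mul_distrib (ladder_mulSupport_finite s M z) (ladder_mulSupport_finite t N w)

theorem finprod_poch_mul_mul_sq {a b c : ℕ → ℂ} {l m n : ℕ → ℤ} {s t u z w v : ℂ} {L M N : ℤ}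
    (ha : ∀ i : ℕ, a i = z + s * i) (hl : ∀ i : ℕ, l i = L - 2 * i)
    (hb : ∀ i : ℕ, b i = w + t * i) (hm : ∀ i : ℕ, m i = M - 2 * i)
    (hc : ∀ i : ℕ, c i = v + u * i) (hn : ∀ i : ℕ, n i = N - 2 * i) :
    ∏ᶠ i : ℕ, poch (a i) (l i) * poch (b i) (m i) * poch (c i) (n i) ^ 2 =
      ladder s L z * ladder t M w * ladder u N v ^ 2 := by
  simp only [ha, hl, hb, hm, hc, hn]
  have h1 := ladder_mulSupport_finite s L z
  have h2 := ladder_mulSupport_finite t M w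
  have h3 := ladder_mulSupport_finite u N v
  have h12 := (h1.union h2).subset (Function.mulSupport_mul _ _)
  have h33 := h3.subset (Function.mulSupport_pow _ 2)
  refine (finprod_mul_distrib h12 h33).trans ?_
  congr 1
  · exact finprod_mul_distrib h1 h2
  · exact (finprod_pow h3 2).symm

theorem three_zpow_mul_one_sub_pow {q : ℂ} (hq : q ^ 2 + q + 1 = 0) (r : ℕ) :
    (3 : ℂ) ^ (-(r : ℤ)) * (1 - q) ^ (2 * r) = (-q) ^ r := by
  rw [zpow_neg, zpow_natCast, pow_mul, show (1 - q) ^ 2 = 3 * -q by linear_combination hq, mul_pow,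
    inv_mul_cancel_left₀ (pow_ne_zero _ three_ne_zero)]

/-! ### The evaluation theorem -/

theorem mainTheorem4 (q : ℂ) (hq : IsPrimitiveRoot q 3) (k : ℤ) (x : ℂ) :
    (∀ n : ℕ, dDet n (6 * k + 1) x q =
      2 ^ ((n / 2) * ((n + 1) / 2)) * factQuot ((n + 1) / 2) n *
        (∏ᶠ i : ℕ,
          poch (x / 2 + 3 * (i : ℂ) + 1) (((n : ℤ) - 4 * (i : ℤ)) / 2) *
          poch (x / 2 + 3 * (i : ℂ) + 3) (((n : ℤ) - 4 * (i : ℤ) - 3) / 2)) *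
        (∏ᶠ i : ℕ,
          poch (x / 2 + (n : ℂ) - (i : ℂ) + 1 / 2) (((n : ℤ) - 4 * (i : ℤ) - 1) / 2) *
          poch (x / 2 + (n : ℂ) - (i : ℂ) - 1 / 2) (((n : ℤ) - 4 * (i : ℤ) - 2) / 2))) ∧
    (∀ n : ℕ, dDet n (6 * k + 2) x q =
      2 ^ ((n / 2) * ((n + 1) / 2)) * 3 ^ (-((n / 2 : ℕ) : ℤ)) * (1 - q) ^ n *
        factQuot ((n + 1) / 2) n *
        (∏ᶠ i : ℕ,
          poch (x / 2 + (n : ℂ) - (i : ℂ)) (((n : ℤ) - 4 * (i : ℤ)) / 2) *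
          poch (x / 2 + (n : ℂ) - (i : ℂ)) (((n : ℤ) - 4 * (i : ℤ) - 3) / 2)) *
        (∏ᶠ i : ℕ,
          poch (x / 2 + 3 * (i : ℂ) + 3 / 2) (((n : ℤ) - 4 * (i : ℤ) - 1) / 2) *
          poch (x / 2 + 3 * (i : ℂ) + 5 / 2) (((n : ℤ) - 4 * (i : ℤ) - 2) / 2))) ∧
    (∀ n : ℕ, dDet n (6 * k + 3) x q =
      (-q) ^ n *
        2 ^ ((((n + 1) / 2 : ℕ) : ℤ) * (((n + 2) / 2 : ℕ) : ℤ) - ((n / 2 : ℕ) : ℤ)) *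
        factQuot ((n + 1) / 2) n *
        (∏ᶠ i : ℕ,
          poch (x / 2 + 3 * (i : ℂ) + 2) (((n : ℤ) - 4 * (i : ℤ) - 1) / 2) *
          poch (x / 2 + 3 * (i : ℂ) + 2) (((n : ℤ) - 4 * (i : ℤ) - 2) / 2)) *
        (∏ᶠ i : ℕ,
          poch (x / 2 + 2 * (((n : ℤ) / 2 : ℤ) : ℂ) - (i : ℂ) + 1 / 2)
            (((n : ℤ) - 4 * (i : ℤ)) / 2) *
          poch (x / 2 + 2 * ((((n : ℤ) - 1) / 2 : ℤ) : ℂ) - (i : ℂ) + 3 / 2)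
            (((n : ℤ) - 4 * (i : ℤ) - 3) / 2))) ∧
    (∀ n : ℕ, dDet n (6 * k + 4) x q = q ^ (-(n : ℂ) / 2) * dDet n (6 * k + 2) x q) ∧
    (∀ n : ℕ, dDet n (6 * k + 5) x q = q ^ (-(n : ℤ)) * dDet n (6 * k + 1) x q) ∧
    (∀ n : ℕ, dDet (2 * n + 1) (6 * k) x q = 0) ∧
    (∀ n : ℕ, dDet (2 * n) (6 * k) x q =
      q ^ ((n : ℂ) / 2) * 2 ^ (n ^ 2) * factQuot n (2 * n) *
        (∏ᶠ i : ℕ,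
          poch (x / 2 + 3 * (i : ℂ) + 1 / 2) ((n : ℤ) - 2 * (i : ℤ)) *
          poch (x / 2 + 3 * (i : ℂ) + 7 / 2) ((n : ℤ) - 2 * ((i : ℤ) + 1)) *
          poch (x / 2 + 2 * (n : ℂ) - (i : ℂ)) ((n : ℤ) - 2 * (i : ℤ) - 1) ^ 2)) := by
  have hq3 := hq.pow_eq_one
  have hs := hq.sq_add_self_add_one
  have hq0 := ne_zero_of_sq_add_self_add_one hs
  have h60 : ∀ n, dDet n (6 * k) x q = dDet n 0 x q := fun n => by
    have h := dDet_add_six_mul n 0 k x hq3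
    rwa [add_zero] at h
  refine ⟨fun n => ?_, fun n => ?_, fun n => ?_, fun n => ?_, fun n => ?_, fun n => ?_,
    fun n => ?_⟩
  · rw [dDet_add_six_mul n 1 k x hq3]
    obtain ⟨r, rfl | rfl⟩ := Nat.even_or_odd' n
    · rw [dDet_even_one r x hs,
        finprod_poch_mul (z := x / 2 + 1) (s := 3) (M := r) (w := x / 2 + 3) (t := 3) (N := r - 2)
          (fun i => by ring) (fun i => by omega) (fun i => by ring) (fun i => by omega),
        finprod_poch_mul (z := x / 2 + 2 * r + 1 / 2) (s := -1) (M := r - 1)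
          (w := x / 2 + 2 * r - 1 / 2) (t := -1) (N := r - 1)
          (fun i => by push_cast; ring) (fun i => by omega)
          (fun i => by push_cast; ring) (fun i => by omega), weight, evenProd1]
      ring
    · rw [dDet_odd_one r x hs,
        finprod_poch_mul (z := x / 2 + 1) (s := 3) (M := r) (w := x / 2 + 3) (t := 3) (N := r - 1)
          (fun i => by ring) (fun i => by omega) (fun i => by ring) (fun i => by omega),
        finprod_poch_mul (z := x / 2 + 2 * r + 3 / 2) (s := -1) (M := r)
          (w := x / 2 + 2 * r + 1 / 2) (t := -1) (N := r - 1)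
          (fun i => by push_cast; ring) (fun i => by omega)
          (fun i => by push_cast; ring) (fun i => by omega), weight, oddProd1]
      ring
  · rw [dDet_add_six_mul n 2 k x hq3]
    obtain ⟨r, rfl | rfl⟩ := Nat.even_or_odd' n
    · have h3 := three_zpow_mul_one_sub_pow hs r
      rw [dDet_even_two r x hs,
        finprod_poch_mul (z := x / 2 + 2 * r) (s := -1) (M := r)
          (w := x / 2 + 2 * r) (t := -1) (N := r - 2)
          (fun i => by push_cast; ring) (fun i => by omega)
          (fun i => by push_cast; ring) (fun i => by omega),
        finprod_poch_mul (z := x / 2 + 3 / 2) (s := 3) (M := r - 1)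
          (w := x / 2 + 5 / 2) (t := 3) (N := r - 1)
          (fun i => by ring) (fun i => by omega) (fun i => by ring) (fun i => by omega), ← h3,
        show 2 * r / 2 = r by omega, weight, evenProd2, show 2 * r / 2 = r by omega]
      ring
    · have h3 := three_zpow_mul_one_sub_pow hs r
      rw [dDet_odd_two r x hs,
        finprod_poch_mul (z := x / 2 + 2 * r + 1) (s := -1) (M := r)
          (w := x / 2 + 2 * r + 1) (t := -1) (N := r - 1)
          (fun i => by push_cast; ring) (fun i => by omega)
          (fun i => by push_cast; ring) (fun i => by omega),
        finprod_poch_mul (z := x / 2 + 3 / 2) (s := 3) (M := r)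
          (w := x / 2 + 5 / 2) (t := 3) (N := r - 1)
          (fun i => by ring) (fun i => by omega) (fun i => by ring) (fun i => by omega), ← h3,
        weight, oddProd2, show (2 * r + 1) / 2 = r by omega, pow_succ (1 - q)]
      ring
  · rw [dDet_add_six_mul n 3 k x hq3]
    obtain ⟨r, rfl | rfl⟩ := Nat.even_or_odd' n
    · have he : (((2 * r + 1) / 2 : ℕ) : ℤ) * (((2 * r + 2) / 2 : ℕ) : ℤ) - ((2 * r / 2 : ℕ) : ℤ) =
          ((r * r : ℕ) : ℤ) := by
        rw [show (2 * r + 1) / 2 = r by omega, show (2 * r + 2) / 2 = r + 1 by omega,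
          show 2 * r / 2 = r by omega]
        push_cast
        ring
      have h1 : ((2 * r : ℕ) : ℤ) / 2 = r := by omega
      have h2 : (((2 * r : ℕ) : ℤ) - 1) / 2 = r - 1 := by omega
      rw [dDet_even_three r x hs, he, zpow_natCast, h1, h2,
        finprod_poch_mul (z := x / 2 + 2) (s := 3) (M := r - 1)
          (w := x / 2 + 2) (t := 3) (N := r - 1)
          (fun i => by ring) (fun i => by omega) (fun i => by ring) (fun i => by omega),
        finprod_poch_mul (z := x / 2 + 2 * r + 1 / 2) (s := -1) (M := r)
          (w := x / 2 + 2 * r - 1 / 2) (t := -1) (N := r - 2)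
          (fun i => by push_cast; ring) (fun i => by omega)
          (fun i => by push_cast; ring) (fun i => by omega), weight_even, evenProd3,
        show (2 * r + 1) / 2 = r by omega, pow_mul' (-q) 2 r]
      ring
    · have he : (((2 * r + 1 + 1) / 2 : ℕ) : ℤ) * (((2 * r + 1 + 2) / 2 : ℕ) : ℤ) -
          (((2 * r + 1) / 2 : ℕ) : ℤ) = ((r * (r + 1) + 1 : ℕ) : ℤ) := by
        rw [show (2 * r + 1 + 1) / 2 = r + 1 by omega, show (2 * r + 1 + 2) / 2 = r + 1 by omega,
          show (2 * r + 1) / 2 = r by omega]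
        push_cast
        ring
      have h1 : ((2 * r + 1 : ℕ) : ℤ) / 2 = r := by omega
      have h2 : (((2 * r + 1 : ℕ) : ℤ) - 1) / 2 = r := by omega
      rw [dDet_odd_three r x hs, he, zpow_natCast, h1, h2,
        finprod_poch_mul (z := x / 2 + 2) (s := 3) (M := r)
          (w := x / 2 + 2) (t := 3) (N := r - 1)
          (fun i => by ring) (fun i => by omega) (fun i => by ring) (fun i => by omega),
        finprod_poch_mul (z := x / 2 + 2 * r + 1 / 2) (s := -1) (M := r)
          (w := x / 2 + 2 * r + 3 / 2) (t := -1) (N := r - 1)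
          (fun i => by push_cast; ring) (fun i => by omega)
          (fun i => by push_cast; ring) (fun i => by omega), weight_odd, oddProd3,
        show (2 * r + 1 + 1) / 2 = r + 1 by omega, pow_succ (-q) (2 * r), pow_mul' (-q) 2 r,
        pow_succ (2 : ℂ) (r * (r + 1))]
      ring
  · rw [dDet_add_six_mul n 4 k x hq3, dDet_add_six_mul n 2 k x hq3, dDet_four n x hs,
      cpow_neg_natCast_div_two hs]
  · have hinv : q⁻¹ = -(1 + q) :=
      inv_eq_of_mul_eq_one_right (by linear_combination -hs)
    rw [show 6 * k + 5 = 6 * (k + 1) + -1 by ring, dDet_add_six_mul n (-1) (k + 1) x hq3,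
      dDet_add_six_mul n 1 k x hq3, dDet_neg_one n x hs, zpow_neg, zpow_natCast, ← inv_pow, hinv]
  · rw [h60, dDet_odd_zero n x hq0]
  · rw [h60, dDet_even_zero n x hs, cpow_natCast_div_two hs,
      finprod_poch_mul_mul_sq (z := x / 2 + 1 / 2) (s := 3) (L := n) (w := x / 2 + 7 / 2) (t := 3)
        (M := n - 2) (v := x / 2 + 2 * n) (u := -1) (N := n - 1)
        (fun i => by ring) (fun i => by ring) (fun i => by ring) (fun i => by ring)
        (fun i => by ring) (fun i => by ring), weight_even, evenProd0, sq n]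
    ring
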